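/- **Theorem.** Let $\beta\colon\mathbb R_+=[0,\infty)\to(0,1)$ be continuous and let $\beta^*=\sup_{t\ge 0}\beta(t)$. Let $L\colon(0,\infty)\to\mathbb R$ be slowly varying, i.e. $L(\lambda t)/L(t)\to 1$ as $t\to\infty$ for every $\lambda>0$, and let $\{J_{nk},\,n\ge1,\,k\ge1\}$ be independent, almost surely non-negative random variables on a probability space such that $$\mathbb P(J_{nk}>t)=t^{-\beta(k/n)}\,L\bigl(t^{\beta(k/n)/\beta^*}\bigr)\qquad\text{for all } t>0,\ n\ge1,\ k\ge1 .$$ Let $a_n>0$, $n\ge1$, satisfy $a_n^{-\beta^*}L(a_n)=\frac1n$ for all sufficiently large $n$, and put $b_{nk}=a_n^{\beta^*/\beta(k/n)}$. Let $\Pi$ be a Poisson point process on $\mathbb R_+\times(0,\infty)$ with intensity measure $\nu(dt,dx)=\beta(t)\,x^{-\beta(t)-1}\,dt\,dx$. Then the point processes $$N_n=\sum_{k=1}^{\infty}\delta_{(k/n,\;b_{nk}^{-1}J_{nk})}$$ on $\mathbb R_+\times(0,\infty)$ (pairs with $J_{nk}=0$, which lie outside this space, are not counted) converge weakly to $\Pi$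 as $n\to\infty$; that is, they converge in distribution as random elements of the space of point measures on $\mathbb R_+\times(0,\infty)$ that are finite on compact sets, with the vague topology (generated by the maps $m\mapsto\int f\,dm$, $f$ continuous with compact support in $\mathbb R_+\times(0,\infty)$). -/

import Mathlib

open MeasureTheory ProbabilityTheory Filter Topology
open scoped NNReal ENNReal CompactlySupported

noncomputable section

/-- A point measure on `E`: a measure which is a countable sum of Dirac masses (repetitions
allowed) and which is finite on compact sets. -/
structure PointMeasure (E : Type*) [TopologicalSpace E] [MeasurableSpace E] where
  toMeasure : Measure E
  finite_compact : ∀ K : Set E, IsCompact K → toMeasure K < ∞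
  isSum : ∃ (ι : Type) (_ : Countable ι) (x : ι → E),
    toMeasure = Measure.sum fun i => Measure.dirac (x i)

namespace PointMeasure

variable {E : Type*} [TopologicalSpace E] [MeasurableSpace E]

/-- The vague topology: the coarsest topology for which `μ ↦ ∫ f dμ` is continuous for every
continuous function `f` with compact support. -/
instance vagueTopology : TopologicalSpace (PointMeasure E) :=
  TopologicalSpace.induced
    (fun (μ : PointMeasure E) (f : C_c(E, ℝ)) => ∫ x, f x ∂μ.toMeasure) inferInstance

instance measurableSpace : MeasurableSpace (PointMeasure E) := borel (PointMeasure E)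

instance borelSpace : BorelSpace (PointMeasure E) := ⟨rfl⟩

end PointMeasure

/-- `Pi` is a Poisson point process on `E` with intensity measure `ν`, defined on the probability
space `(Ω, P)`: a random point measure such that the number of points in a measurable set `B` is
Poisson distributed with mean `ν B` (almost surely infinite if `ν B = ∞`), and the numbers of
points in finitely many pairwise disjoint measurable sets are independent. -/
structure IsPoissonPointProcess {E Ω : Type*} [TopologicalSpace E] [MeasurableSpace E]
    [MeasurableSpace Ω] (Pi : Ω → PointMeasure E) (ν : Measure E) (P : Measure Ω) : Prop where
  measurable : Measurable Pi
  hasLaw_count : ∀ B : Set E, MeasurableSet B → ν B ≠ ∞ →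
    HasLaw (fun ω => (Pi ω).toMeasure B)
      ((poissonMeasure (ν B).toNNReal).map (fun m : ℕ => (m : ℝ≥0∞))) P
  count_eq_top : ∀ B : Set E, MeasurableSet B → ν B = ∞ → ∀ᵐ ω ∂P, (Pi ω).toMeasure B = ∞
  indep_count : ∀ (m : ℕ) (B : Fin m → Set E), (∀ i, MeasurableSet (B i)) →
    Pairwise (fun i j => Disjoint (B i) (B j)) →
    iIndepFun (fun i ω => (Pi ω).toMeasure (B i)) P

/-- `L (c t) / L t → 1` as `t → ∞`, for every `c > 0`. -/
def IsSlowlyVarying (L : ℝ → ℝ) : Prop :=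
  ∀ c : ℝ, 0 < c → Tendsto (fun t => L (c * t) / L t) atTop (𝓝 1)

/-- The state space `[0, ∞) × (0, ∞)`. -/
abbrev StateSpace : Type := ℝ≥0 × Set.Ioi (0 : ℝ)

/-- The measure `β(t) x ^ (-β(t) - 1) dt dx` on `[0, ∞) × (0, ∞)`. -/
def multistableIntensity (β : ℝ≥0 → ℝ) : Measure StateSpace :=
  (((volume : Measure ℝ).comap ((↑) : ℝ≥0 → ℝ)).prod
    ((volume : Measure ℝ).comap ((↑) : Set.Ioi (0 : ℝ) → ℝ))).withDensity fun p =>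
    ENNReal.ofReal (β p.1 * (p.2 : ℝ) ^ (-β p.1 - 1))

/-- The time point `k / n`. -/
def gridTime (n k : ℕ+) : ℝ≥0 := ((k : ℕ) : ℝ≥0) / ((n : ℕ) : ℝ≥0)

/-- The supremum `β^*` of `β`. -/
def indexSup (β : ℝ≥0 → ℝ) : ℝ := ⨆ t, β t

/-- The normalizing constants `b_{nk} = a_n ^ (β^* / β(k/n))`. -/
def normConst (β : ℝ≥0 → ℝ) (a : ℕ+ → ℝ) (n k : ℕ+) : ℝ :=
  a n ^ (indexSup β / β (gridTime n k))

/-- For a row `y 1, y 2, …` of real numbers, the point measure `∑ k, δ_(k/n, y k)` on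
`[0, ∞) × (0, ∞)`; pairs `(k/n, y k)` outside the state space do not contribute. -/
def rowPointMeasure (n : ℕ+) (y : ℕ+ → ℝ) : PointMeasure StateSpace where
  toMeasure := Measure.sum fun k : {k : ℕ+ // 0 < y k} =>
    Measure.dirac ((gridTime n k, ⟨y k, k.2⟩) : StateSpace)
  finite_compact := by
    intro K hK
    obtain ⟨T, hT⟩ := (hK.image continuous_fst).bddAbove
    obtain ⟨M, hM⟩ := exists_nat_gt (T * ((n : ℕ) : ℝ≥0))
    have hn : (0 : ℝ≥0) < ((n : ℕ) : ℝ≥0) := by exact_mod_cast n.pos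
    have hfin : Set.Finite {k : {k : ℕ+ // 0 < y k} | (k : ℕ+) ≤ (⟨M + 1, M.succ_pos⟩ : ℕ+)} :=
      (Set.finite_Iic _).preimage Subtype.val_injective.injOn
    rw [Measure.sum_apply _ hK.measurableSet, tsum_eq_sum (s := hfin.toFinset)]
    · exact ENNReal.sum_lt_top.2 fun k _ => measure_lt_top _ _
    · intro k hk
      rw [Measure.dirac_apply' _ hK.measurableSet, Set.indicator_of_notMem]
      intro hmem
      apply hk
      have h1 : gridTime n k ≤ T := hT ⟨_, hmem, rfl⟩
      rw [gridTime, div_le_iff₀ hn] at h1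
      have h2 : (((k : ℕ+) : ℕ) : ℝ≥0) < (M : ℝ≥0) := h1.trans_lt hM
      have h3 : ((k : ℕ+) : ℕ) < M := by exact_mod_cast h2
      simp only [Set.Finite.mem_toFinset, Set.mem_ofPred_eq]
      exact PNat.coe_le_coe _ _ |>.1 (by simp; omega)
  isSum := ⟨_, inferInstance, _, rfl⟩

end

/-! The coordinate `v = x ^ (-β t)` turns the intensity into Lebesgue measure
(`multistableIntensity_eq_map`). Put α = β^* and G(u) = u^(-α) L(u). The constants b_{nk} are such
that P(b_{nk}⁻¹ J_{nk} > v^(-1/β(k/n))) = G(v^(-1/α) a_n), which no longer depends on k. Since n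
G(a_n) = 1 eventually and a_n → ∞, slow variation gives n G(v^(-1/α) a_n) → v. Hence every time cell
of length 1/n carries, after multiplication by n, a measure in v whose distribution function tends
to that of Lebesgue measure, and no uniformity in L is needed.

The passage from means to laws uses characteristic functionals E exp(i∫f dN). For Π this is exp
∫(e^{if} - 1) dν (`IsPoissonPointProcess.integral_exp`). For N_n independence gives a finite product
of factors 1 + z_{nj}, where z_{nj} is the mean of e^{if} - 1 at one point. The sum of the z_{nj}
tends to ∫(e^{if} - 1) dν by dominated convergence in t, and max |z_{nj}| = O(1/n), so the products
tend to the exponential (`tendsto_prod_one_add_of_tendsto_sum`).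

The functionals determine weak convergence through
`tendsto_probabilityMeasure_of_tendsto_integral_exp`: the vague topology is second countable, so
open sets are approximated in probability from inside by finite-dimensional ones. The limit law
being given, no tightness of point processes has to be proved. -/

namespace PointMeasure

/-! ### Second countability of the vague topology -/

section Vague

variable {E : Type*} [TopologicalSpace E] [MeasurableSpace E]

instance isFiniteMeasureOnCompacts (μ : PointMeasure E) :
    IsFiniteMeasureOnCompacts μ.toMeasure :=
  ⟨fun K hK => μ.finite_compact K hK⟩

/-- Integration of a fixed test function is vaguely continuous. -/
theorem continuous_integral (f : C_c(E, ℝ)) :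
    Continuous fun μ : PointMeasure E => ∫ x, f x ∂μ.toMeasure :=
  (continuous_apply f).comp (continuous_induced_dom (f := fun (μ : PointMeasure E)
    (f : C_c(E, ℝ)) => ∫ x, f x ∂μ.toMeasure))

theorem integrable_of_hasCompactSupport [OpensMeasurableSpace E] {F : Type*}
    [NormedAddCommGroup F] [SecondCountableTopologyEither E F] (μ : PointMeasure E)
    {f : E → F} (hf : Continuous f) (hc : HasCompactSupport f) : Integrable f μ.toMeasure :=
  hf.integrable_of_hasCompactSupport hc

/-- A countable family of test functions which approximates all test functions uniformly,
relative to a member of the family. -/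
theorem _root_.CompactlySupportedContinuousMap.exists_countable_approximating
    {E : Type*} [TopologicalSpace E] [T2Space E] [LocallyCompactSpace E]
    [SecondCountableTopology E] :
    ∃ S : Set C_c(E, ℝ), S.Countable ∧ ∀ f : C_c(E, ℝ), ∃ g ∈ S, (∀ x, 0 ≤ g x) ∧
      ∀ ε : ℝ, 0 < ε → ∃ h ∈ S, ∀ x, |f x - h x| ≤ ε * g x := by
  classical
  let K : CompactExhaustion E := CompactExhaustion.choice E
  have hχ : ∀ m, ∃ χ : C(E, ℝ), Set.EqOn χ 1 (K m) ∧ HasCompactSupport χ ∧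
      ∀ x, χ x ∈ Set.Icc (0 : ℝ) 1 := by
    intro m
    obtain ⟨χ, h1, -, h3, h4⟩ := exists_continuous_one_zero_of_isCompact (K.isCompact m)
      isClosed_empty (Set.disjoint_empty _)
    exact ⟨χ, h1, h3, h4⟩
  choose χ hχ1 hχc hχI using hχ
  obtain ⟨D, hDc, hDd⟩ := TopologicalSpace.exists_countable_dense C(E, ℝ)
  -- Density in the compact-open topology gives uniform approximation on the support of a cutoff `χ
  -- m`; multiplying by `χ m` makes the error bound global and relative to `G m 1`.
  let G : ℕ → C(E, ℝ) → C_c(E, ℝ) := fun m d => ⟨χ m * d, (hχc m).mul_right⟩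
  refine ⟨(⋃ m, {G m 1}) ∪ ⋃ m, G m '' D, (Set.countable_iUnion fun m =>
    Set.countable_singleton _).union (Set.countable_iUnion fun m => hDc.image _), fun f => ?_⟩
  obtain ⟨m, hm⟩ := K.exists_superset_of_isCompact f.hasCompactSupport.isCompact
  refine ⟨G m 1, Or.inl (Set.mem_iUnion.2 ⟨m, rfl⟩), fun x => ?_, fun ε hε => ?_⟩
  · simpa [G] using (hχI m x).1
  have hopen : IsOpen {d : C(E, ℝ) | Set.MapsTo (f.toContinuousMap - d) (tsupport (χ m))
      (Metric.ball 0 ε)} :=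
    (ContinuousMap.isOpen_setOfPred_mapsTo (hχc m).isCompact Metric.isOpen_ball).preimage
      (continuous_const.sub continuous_id)
  obtain ⟨d, hdD, hd⟩ := hDd.exists_mem_open hopen
    ⟨f.toContinuousMap, fun x _ => by simpa using hε⟩
  refine ⟨G m d, Or.inr (Set.mem_iUnion.2 ⟨m, d, hdD, rfl⟩), fun x => ?_⟩
  have hfx : f x = χ m x * f x := by
    by_cases hx : x ∈ tsupport f
    · rw [hχ1 m (hm hx)]; simp
    · rw [image_eq_zero_of_notMem_tsupport hx, mul_zero]
  have h0 := (hχI m x).1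
  have key : |f x - χ m x * d x| = χ m x * |f x - d x| := by
    rw [← abs_of_nonneg h0, ← abs_mul, abs_of_nonneg h0, mul_sub, ← hfx]
  change |f x - χ m x * d x| ≤ ε * (χ m x * 1)
  rw [key, mul_one, mul_comm ε]
  by_cases hx : x ∈ tsupport (χ m)
  · have := hd hx
    rw [mem_ball_zero_iff, Real.norm_eq_abs] at this
    exact mul_le_mul_of_nonneg_left this.le h0
  · rw [image_eq_zero_of_notMem_tsupport hx]; simp

/-- The vague topology on point measures is second countable. -/
instance secondCountableTopology [T2Space E] [LocallyCompactSpace E]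
    [SecondCountableTopology E] [OpensMeasurableSpace E] :
    SecondCountableTopology (PointMeasure E) := by
  obtain ⟨S, hS, happ⟩ :=
    CompactlySupportedContinuousMap.exists_countable_approximating (E := E)
  have := hS.to_subtype
  let ψ : PointMeasure E → S → ℝ := fun μ f => ∫ x, f.1 x ∂μ.toMeasure
  suffices h : (vagueTopology : TopologicalSpace (PointMeasure E)) =
      TopologicalSpace.induced ψ inferInstance by
    rw [h]
    exact TopologicalSpace.secondCountableTopology_induced _ _ ψ
  apply le_antisymm
  · rw [← continuous_iff_le_induced]
    exact continuous_pi fun f => continuous_integral f.1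
  · let τ : TopologicalSpace (PointMeasure E) := TopologicalSpace.induced ψ inferInstance
    have hψ : ∀ f ∈ S, Continuous fun μ : PointMeasure E => ∫ x, f x ∂μ.toMeasure := fun f hf =>
      (continuous_apply (⟨f, hf⟩ : S)).comp (continuous_induced_dom (f := ψ))
    refine (continuous_iff_le_induced (f := fun (μ : PointMeasure E) (f : C_c(E, ℝ)) =>
      ∫ x, f x ∂μ.toMeasure)).1 (continuous_pi fun f => continuous_iff_continuousAt.2 fun μ₀ => ?_)
    obtain ⟨g, hg, hg0, hap⟩ := happ f
    -- Near `μ₀` the integral of `g` stays below `M`, so an error of `ε / (2 * M) * g` in the test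
    -- function costs at most `ε / 2` for all these measures at once.
    apply continuousAt_of_locally_uniform_approx_of_continuousAt
    intro u hu
    obtain ⟨ε, hε, hεu⟩ := Metric.mem_uniformity_dist.1 hu
    set M : ℝ := ∫ x, g x ∂μ₀.toMeasure + 1 with hM
    have hMpos : 0 < M := by
      have : 0 ≤ ∫ x, g x ∂μ₀.toMeasure := integral_nonneg hg0
      linarith
    obtain ⟨h, hh, hfh⟩ := hap (ε / (2 * M)) (by positivity)
    refine ⟨{μ | ∫ x, g x ∂μ.toMeasure < M}, ((hψ g hg).continuousAt).preimage_mem_nhds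
      (Iio_mem_nhds (by linarith)), _, (hψ h hh).continuousAt, fun μ hμ => hεu ?_⟩
    have hfi : Integrable (fun x => f x) μ.toMeasure :=
      μ.integrable_of_hasCompactSupport f.continuous f.hasCompactSupport
    have hgi : Integrable (fun x => g x) μ.toMeasure :=
      μ.integrable_of_hasCompactSupport g.continuous g.hasCompactSupport
    have hhi : Integrable (fun x => h x) μ.toMeasure :=
      μ.integrable_of_hasCompactSupport h.continuous h.hasCompactSupport
    rw [Real.dist_eq, ← integral_sub hfi hhi]
    calc |∫ x, (f x - h x) ∂μ.toMeasure| ≤ ∫ x, |f x - h x| ∂μ.toMeasure :=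
          abs_integral_le_integral_abs
      _ ≤ ∫ x, ε / (2 * M) * g x ∂μ.toMeasure :=
          integral_mono (hfi.sub hhi).abs (hgi.const_mul _) hfh
      _ = ε / (2 * M) * ∫ x, g x ∂μ.toMeasure := integral_const_mul _ _
      _ ≤ ε / (2 * M) * M := by gcongr; exact le_of_lt hμ
      _ < ε := by field_simp; linarith

end Vague

end PointMeasure

/-! ### Weak convergence from finite-dimensional characteristic functions -/

section FiniteDimensional

variable {X ι : Type*}

/-- In a topology induced by a map into a product, every point of an open set has a
finite-dimensional open neighbourhood inside it. -/
theorem exists_finset_isOpen_of_induced [TopologicalSpace X] {φ : X → ι → ℝ}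
    (hφ : IsInducing φ) {G : Set X}
    (hG : IsOpen G) {x : X} (hx : x ∈ G) :
    ∃ (s : Finset ι) (O : Set (s → ℝ)), IsOpen O ∧ s.restrict (φ x) ∈ O ∧
      (fun y => s.restrict (φ y)) ⁻¹' O ⊆ G := by
  obtain ⟨G', hG', rfl⟩ := hφ.isOpen_iff.1 hG
  obtain ⟨s, u, hu, hsub⟩ := isOpen_pi_iff.1 hG' (φ x) hx
  refine ⟨s, Set.univ.pi fun i => u i, isOpen_set_pi Set.finite_univ fun i _ => (hu i i.2).1,
    fun i _ => (hu i i.2).2, fun y hy => hsub fun i hi => hy ⟨i, hi⟩ trivial⟩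

/-- Finite unions of finite-dimensional open sets are finite-dimensional open sets. -/
theorem exists_finset_isOpen_biUnion {φ : X → ι → ℝ} (T : Finset (Set X))
    (hT : ∀ t ∈ T, ∃ (s : Finset ι) (O : Set (s → ℝ)), IsOpen O ∧
      (fun y => s.restrict (φ y)) ⁻¹' O = t) :
    ∃ (s : Finset ι) (O : Set (s → ℝ)), IsOpen O ∧
      (fun y => s.restrict (φ y)) ⁻¹' O = ⋃ t ∈ T, t := by
  classical
  induction T using Finset.induction_on with
  | empty => exact ⟨∅, ∅, isOpen_empty, by simp⟩
  | insert a T _ ih =>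
    obtain ⟨s₁, O₁, hO₁, h₁⟩ := hT a (Finset.mem_insert_self _ _)
    obtain ⟨s₂, O₂, hO₂, h₂⟩ := ih fun t ht => hT t (Finset.mem_insert_of_mem ht)
    refine ⟨s₁ ∪ s₂, Finset.restrict₂ (π := fun _ => ℝ) Finset.subset_union_left ⁻¹' O₁ ∪
      Finset.restrict₂ (π := fun _ => ℝ) Finset.subset_union_right ⁻¹' O₂,
      (hO₁.preimage (continuous_pi fun i => continuous_apply _)).union
        (hO₂.preimage (continuous_pi fun i => continuous_apply _)), ?_⟩
    rw [Finset.set_biUnion_insert, ← h₁, ← h₂]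
    rfl

variable [TopologicalSpace X] [MeasurableSpace X] [BorelSpace X] [SecondCountableTopology X]

/-- Measurability into a second countable space whose topology is induced by real functions. -/
theorem measurable_of_isInducing_pi {Ω : Type*} [MeasurableSpace Ω] {φ : X → ι → ℝ}
    (hφ : IsInducing φ) {Z : Ω → X} (hZ : ∀ i, Measurable fun ω => φ (Z ω) i) :
    Measurable Z := by
  let B : Set (Set X) := {t | ∃ (s : Finset ι) (O : Set (s → ℝ)), IsOpen O ∧
      (fun y => s.restrict (φ y)) ⁻¹' O = t}
  have hcont : ∀ s : Finset ι, Continuous fun y => s.restrict (φ y) := fun s =>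
    (continuous_pi fun i => (continuous_apply (i : ι)).comp hφ.continuous)
  have hB : TopologicalSpace.IsTopologicalBasis B := by
    refine TopologicalSpace.isTopologicalBasis_of_isOpen_of_nhds ?_ ?_
    · rintro _ ⟨s, O, hO, rfl⟩
      exact hO.preimage (hcont s)
    · intro x G hx hG
      obtain ⟨s, O, hO, hxO, hsub⟩ := exists_finset_isOpen_of_induced hφ hG hx
      exact ⟨_, ⟨s, O, hO, rfl⟩, hxO, hsub⟩
  have := hB.borel_eq_generateFrom
  rw [← BorelSpace.measurable_eq (α := X)] at this
  rw [this]
  refine measurable_generateFrom ?_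
  rintro _ ⟨s, O, hO, rfl⟩
  have : Measurable fun ω => s.restrict (φ (Z ω)) := measurable_pi_lambda _ fun i => hZ i
  exact this hO.measurableSet

/-- Weak convergence of probability measures on a second countable space whose topology is
induced by real functions `φ i`, from the convergence of the characteristic functions of the
finite linear combinations of the `φ i`. -/
theorem tendsto_probabilityMeasure_of_tendsto_integral_exp {κ : Type*} {l : Filter κ}
    [l.IsCountablyGenerated] {φ : X → ι → ℝ} (hφ : IsInducing φ)
    {Q : κ → ProbabilityMeasure X} {Q₀ : ProbabilityMeasure X}
    (h : ∀ (s : Finset ι) (c : s → ℝ),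
      Tendsto (fun n => ∫ x, Complex.exp (((∑ i, c i * φ x i : ℝ) : ℂ) * Complex.I)
          ∂(Q n : Measure X))
        l (𝓝 (∫ x, Complex.exp (((∑ i, c i * φ x i : ℝ) : ℂ) * Complex.I) ∂(Q₀ : Measure X)))) :
    Tendsto Q l (𝓝 Q₀) := by
  -- As `l` is countably generated, sequences suffice; Lévy's continuity theorem is applied along
  -- them.
  refine tendsto_of_seq_tendsto fun u hu => ?_
  have hfd : ∀ (s : Finset ι) (O : Set (s → ℝ)), IsOpen O →
      (Q₀ : Measure X) ((fun y => s.restrict (φ y)) ⁻¹' O) ≤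
        atTop.liminf fun n => (Q (u n) : Measure X) ((fun y => s.restrict (φ y)) ⁻¹' O) := by
    intro s O hO
    have hcont : Continuous fun y => WithLp.toLp 2 (s.restrict (φ y)) :=
      (PiLp.continuous_toLp 2 _).comp
        (continuous_pi fun i => (continuous_apply (i : ι)).comp hφ.continuous)
    let R : ProbabilityMeasure X → ProbabilityMeasure (EuclideanSpace ℝ s) := fun q =>
      q.map (f := fun y => WithLp.toLp 2 (s.restrict (φ y))) hcont.measurable.aemeasurable
    have hR : Tendsto (fun n => R (Q (u n))) atTop (𝓝 (R Q₀)) := by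
      refine ProbabilityMeasure.tendsto_of_tendsto_charFun fun t => ?_
      have hchar : ∀ q : ProbabilityMeasure X, charFun (R q : Measure (EuclideanSpace ℝ s)) t =
          ∫ x, Complex.exp (((∑ i, t i * φ x i : ℝ) : ℂ) * Complex.I) ∂(q : Measure X) := by
        intro q
        rw [charFun_apply]
        change ∫ x, _ ∂(Measure.map _ _) = _
        rw [integral_map hcont.measurable.aemeasurable
          (by fun_prop)]
        rfl
      simp_rw [hchar]
      exact (h s t).comp hu
    have := ProbabilityMeasure.le_liminf_measure_open_of_tendsto hR
      (hO.preimage (PiLp.continuous_ofLp 2 _))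
    have hmap : ∀ q : ProbabilityMeasure X, (R q : Measure (EuclideanSpace ℝ s))
        (WithLp.ofLp ⁻¹' O) = (q : Measure X) ((fun y => s.restrict (φ y)) ⁻¹' O) := fun q =>
      Measure.map_apply hcont.measurable (hO.preimage (PiLp.continuous_ofLp 2 _)).measurableSet
    simpa only [hmap] using this
  refine tendsto_of_forall_isOpen_le_liminf' fun G hG => ?_
  refine le_of_forall_lt fun r hr => ?_
  lift r to ℝ≥0 using (hr.trans_le le_top).ne
  have hr' : r < Q₀ G := by
    rwa [← ProbabilityMeasure.ennreal_coeFn_eq_coeFn_toMeasure, ENNReal.coe_lt_coe] at hr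
  -- Inner approximation of `G` by a finite union of cylinders, hence by a single cylinder, for
  -- which the liminf inequality is known.
  obtain ⟨T, hTS, hrT, hTG⟩ := Q₀.exists_lt_measure_biUnion_of_isOpen
    (S := {t | ∃ (s : Finset ι) (O : Set (s → ℝ)), IsOpen O ∧
      (fun y => s.restrict (φ y)) ⁻¹' O = t}) (fun G hG x hx => by
        obtain ⟨s, O, hO, hxO, hsub⟩ := exists_finset_isOpen_of_induced hφ hG hx
        refine ⟨_, ⟨s, O, hO, rfl⟩, IsOpen.mem_nhds (hO.preimage ?_) hxO, hsub⟩
        exact continuous_pi fun i => (continuous_apply (i : ι)).comp hφ.continuous) hG hr'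
  obtain ⟨s, O, hO, hOT⟩ := exists_finset_isOpen_biUnion T hTS
  rw [← ENNReal.coe_lt_coe, ProbabilityMeasure.ennreal_coeFn_eq_coeFn_toMeasure] at hrT
  refine hrT.trans_le ?_
  rw [← hOT] at hTG ⊢
  exact (hfd s O hO).trans (liminf_le_liminf (.of_forall fun n => measure_mono hTG))

end FiniteDimensional

/-! ### Characteristic functional of a Poisson process -/

section PoissonFunctional

variable {E Ω : Type*} [TopologicalSpace E] [MeasurableSpace E] [MeasurableSpace Ω]
  {Pi : Ω → PointMeasure E} {ν : Measure E} {P : Measure Ω}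

theorem IsPoissonPointProcess.aemeasurable_count (hPi : IsPoissonPointProcess Pi ν P) {B : Set E}
    (hB : MeasurableSet B) (hν : ν B ≠ ∞) :
    AEMeasurable (fun ω => (Pi ω).toMeasure B) P :=
  (hPi.hasLaw_count B hB hν).aemeasurable

theorem IsPoissonPointProcess.integral_exp_count (hPi : IsPoissonPointProcess Pi ν P) {B : Set E}
    (hB : MeasurableSet B) (hν : ν B ≠ ∞) (c : ℝ) :
    ∫ ω, Complex.exp (((Pi ω).toMeasure.real B * c : ℝ) * Complex.I) ∂P =
      Complex.exp (ν.real B * (Complex.exp (c * Complex.I) - 1)) := by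
  have hlaw := hPi.hasLaw_count B hB hν
  have hF : Measurable fun x : ℝ≥0∞ => Complex.exp ((x.toReal * c : ℝ) * Complex.I) := by
    fun_prop
  have h1 := integral_map hlaw.aemeasurable (f := fun x : ℝ≥0∞ =>
    Complex.exp ((x.toReal * c : ℝ) * Complex.I)) hF.aestronglyMeasurable
  have h2 := charFun_map_cast_poissonMeasure (ν B).toNNReal c
  rw [charFun_apply, integral_map .of_discrete (by fun_prop)] at h2
  have h3 : (((ν B).toNNReal : ℝ) : ℂ) = ν.real B := rfl
  rw [← h3, ← h2]
  refine h1.symm.trans ?_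
  rw [hlaw.map_eq, integral_map .of_discrete hF.aestronglyMeasurable]
  congr 1
  ext m
  simp [mul_comm]

theorem IsPoissonPointProcess.integral_exp_sum (hPi : IsPoissonPointProcess Pi ν P) {m : ℕ}
    {B : Fin m → Set E} (hB : ∀ i, MeasurableSet (B i)) (hν : ∀ i, ν (B i) ≠ ∞)
    (hdisj : Pairwise fun i j => Disjoint (B i) (B j)) (c : Fin m → ℝ) :
    ∫ ω, Complex.exp ((∑ i, (Pi ω).toMeasure.real (B i) * c i : ℝ) * Complex.I) ∂P =
      Complex.exp (∑ i, ν.real (B i) * (Complex.exp (c i * Complex.I) - 1)) := by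
  have hF : ∀ i, Measurable fun x : ℝ≥0∞ => Complex.exp ((x.toReal * c i : ℝ) * Complex.I) := by
    intro i
    fun_prop
  have h := (hPi.indep_count m B hB hdisj).integral_fun_prod_comp
    (f := fun i x => Complex.exp ((x.toReal * c i : ℝ) * Complex.I))
    (fun i => hPi.aemeasurable_count (hB i) (hν i)) fun i => (hF i).aestronglyMeasurable
  rw [Complex.exp_sum]
  simp_rw [← hPi.integral_exp_count (hB _) (hν _)]
  refine Eq.trans ?_ h
  congr 1
  ext ω
  rw [← Complex.exp_sum, Complex.ofReal_sum, Finset.sum_mul]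
  rfl

theorem Complex.norm_exp_ofReal_mul_I_sub_one_le (x : ℝ) :
    ‖Complex.exp (x * Complex.I) - 1‖ ≤ ‖x‖ := by
  rw [mul_comm]
  exact Real.norm_exp_I_mul_ofReal_sub_one_le

/-- The integral of a simple function is a linear combination of counts on its disjoint level sets,
which are independent Poisson variables. The measurability half serves the dominated convergence
that extends the formula to test functions. -/
theorem IsPoissonPointProcess.integral_exp_simpleFunc (hPi : IsPoissonPointProcess Pi ν P)
    (s : SimpleFunc E ℝ) (hν : ∀ c, c ≠ 0 → ν (s ⁻¹' {c}) ≠ ∞)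
    (hs : ∀ ω, Integrable s (Pi ω).toMeasure) (hsν : Integrable s ν) :
    AEStronglyMeasurable (fun ω => ∫ x, s x ∂(Pi ω).toMeasure) P ∧
    ∫ ω, Complex.exp ((∫ x, s x ∂(Pi ω).toMeasure : ℝ) * Complex.I) ∂P =
      Complex.exp (∫ x, (Complex.exp (s x * Complex.I) - 1) ∂ν) := by
  classical
  let e := s.range.equivFin.symm
  -- The zero level set may have infinite mass; it contributes nothing and is replaced by `∅`.
  let B : Fin s.range.card → Set E := fun i => if (e i : ℝ) = 0 then ∅ else s ⁻¹' {(e i : ℝ)}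
  have hB : ∀ i, MeasurableSet (B i) := by
    intro i
    by_cases h : (e i : ℝ) = 0
    · simp [B, h]
    · simpa [B, h] using s.measurableSet_fiber _
  have hBν : ∀ i, ν (B i) ≠ ∞ := by
    intro i
    by_cases h : (e i : ℝ) = 0
    · simp [B, h]
    · simpa [B, h] using hν _ h
  have hdisj : Pairwise fun i j => Disjoint (B i) (B j) := by
    intro i j hij
    by_cases hi : (e i : ℝ) = 0
    · simp [B, hi]
    by_cases hj : (e j : ℝ) = 0
    · simp [B, hj]
    simp only [B, hi, hj, if_false]
    refine Disjoint.preimage _ (Set.disjoint_singleton.2 fun h => hij ?_)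
    exact e.injective (Subtype.ext h)
  have hsum : ∀ (μ : Measure E) {F : Type} [NormedAddCommGroup F] [NormedSpace ℝ F] (g : ℝ → F),
      g 0 = 0 → ∑ x ∈ s.range, μ.real (s ⁻¹' {x}) • g x = ∑ i, μ.real (B i) • g (e i) := by
    intro μ F _ _ g hg
    rw [← Finset.sum_coe_sort s.range, ← Equiv.sum_comp e]
    refine Finset.sum_congr rfl fun i _ => ?_
    by_cases h : (e i : ℝ) = 0
    · simp [h, hg]
    · simp [B, h]
  have h1 : ∀ ω, ∫ x, s x ∂(Pi ω).toMeasure =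
      ∑ i, (Pi ω).toMeasure.real (B i) * (e i : ℝ) := by
    intro ω
    rw [← SimpleFunc.integral_eq_integral _ (hs ω), SimpleFunc.integral_eq]
    exact hsum _ (fun x => x) rfl
  have h2 : ∫ x, (Complex.exp (s x * Complex.I) - 1) ∂ν =
      ∑ i, ν.real (B i) * (Complex.exp ((e i : ℝ) * Complex.I) - 1) := by
    have hg : (fun x : ℝ => Complex.exp (x * Complex.I) - 1) 0 = 0 := by simp
    have h3 := SimpleFunc.map_integral s (fun x : ℝ => Complex.exp (x * Complex.I) - 1) hsν hg
    have hint : Integrable (s.map fun x : ℝ => Complex.exp (x * Complex.I) - 1) ν :=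
      SimpleFunc.integrable_iff_finMeasSupp.2
        ((SimpleFunc.integrable_iff_finMeasSupp.1 hsν).map hg)
    rw [hsum ν _ hg, SimpleFunc.integral_eq_integral _ hint] at h3
    simpa using h3
  refine ⟨?_, ?_⟩
  · simp_rw [h1]
    refine Finset.aestronglyMeasurable_fun_sum _ fun i _ => ?_
    exact ((hPi.aemeasurable_count (hB i) (hBν i)).ennreal_toReal.mul_const _).aestronglyMeasurable
  · simp_rw [h1, h2]
    exact hPi.integral_exp_sum hB hBν hdisj _

/-- The characteristic functional of a Poisson point process. -/
theorem IsPoissonPointProcess.integral_exp [IsProbabilityMeasure P] [OpensMeasurableSpace E]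
    [IsFiniteMeasureOnCompacts ν] (hPi : IsPoissonPointProcess Pi ν P) (f : C_c(E, ℝ)) :
    ∫ ω, Complex.exp ((∫ x, f x ∂(Pi ω).toMeasure : ℝ) * Complex.I) ∂P =
      Complex.exp (∫ x, (Complex.exp (f x * Complex.I) - 1) ∂ν) := by
  have hfm : Measurable f := f.continuous.measurable
  -- Base value `0` gives `‖s n x‖ ≤ 2 * ‖f x‖`: this is the dominating function, and it keeps the
  -- nonzero level sets inside the compact support of `f`.
  let s : ℕ → SimpleFunc E ℝ := SimpleFunc.approxOn f hfm Set.univ 0 trivial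
  have hsf : ∀ n x, ‖s n x‖ ≤ 2 * ‖f x‖ := fun n x =>
    (SimpleFunc.norm_approxOn_zero_le hfm (Set.mem_univ 0) x n).trans_eq (two_mul _).symm
  have hlim : ∀ x, Tendsto (fun n => s n x) atTop (𝓝 (f x)) := fun x =>
    SimpleFunc.tendsto_approxOn hfm (Set.mem_univ 0) (by simp)
  have hfi : ∀ μ : Measure E, IsFiniteMeasureOnCompacts μ → Integrable (fun x => 2 * ‖f x‖) μ :=
    fun μ _ => (f.continuous.integrable_of_hasCompactSupport f.hasCompactSupport).norm.const_mul 2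
  have hsi : ∀ n (μ : Measure E), IsFiniteMeasureOnCompacts μ → Integrable (s n) μ :=
    fun n μ hμ => (hfi μ hμ).mono' (s n).aestronglyMeasurable (.of_forall (hsf n))
  have hsν : ∀ n c, c ≠ 0 → ν (s n ⁻¹' {c}) ≠ ∞ := by
    intro n c hc
    refine ne_top_of_le_ne_top f.hasCompactSupport.isCompact.measure_lt_top.ne
      (measure_mono fun x hx => ?_)
    by_contra hxf
    have := hsf n x
    rw [image_eq_zero_of_notMem_tsupport hxf, norm_zero, mul_zero, norm_le_zero_iff] at this
    exact hc (hx ▸ this)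
  have hsimple := fun n => hPi.integral_exp_simpleFunc (s n) (hsν n)
    (fun ω => hsi n _ inferInstance) (hsi n ν inferInstance)
  have hdom : ∀ μ : Measure E, IsFiniteMeasureOnCompacts μ →
      Tendsto (fun n => ∫ x, s n x ∂μ) atTop (𝓝 (∫ x, f x ∂μ)) := fun μ hμ =>
    tendsto_integral_of_dominated_convergence _ (fun n => (s n).aestronglyMeasurable)
      (hfi μ hμ) (fun n => .of_forall (hsf n)) (.of_forall hlim)
  have hexp : Continuous fun x : ℝ => Complex.exp (x * Complex.I) := by fun_prop
  have hleft : Tendsto (fun n => ∫ ω, Complex.exp ((∫ x, s n x ∂(Pi ω).toMeasure : ℝ) *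
      Complex.I) ∂P) atTop
      (𝓝 (∫ ω, Complex.exp ((∫ x, f x ∂(Pi ω).toMeasure : ℝ) * Complex.I) ∂P)) := by
    refine tendsto_integral_of_dominated_convergence (fun _ => 1)
      (fun n => hexp.comp_aestronglyMeasurable (hsimple n).1) (integrable_const _)
      (fun n => .of_forall fun ω => (Complex.norm_exp_ofReal_mul_I _).le)
      (.of_forall fun ω => (hexp.tendsto _).comp (hdom _ inferInstance))
  have hright : Tendsto (fun n => ∫ x, (Complex.exp (s n x * Complex.I) - 1) ∂ν) atTop
      (𝓝 (∫ x, (Complex.exp (f x * Complex.I) - 1) ∂ν)) := by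
    refine tendsto_integral_of_dominated_convergence _ (fun n => ?_) (hfi ν inferInstance)
      (fun n => .of_forall fun x => (Complex.norm_exp_ofReal_mul_I_sub_one_le _).trans (hsf n x))
      (.of_forall fun x => ((hexp.tendsto _).comp (hlim x)).sub_const 1)
    exact (hexp.comp_aestronglyMeasurable (s n).aestronglyMeasurable).sub aestronglyMeasurable_const
  refine tendsto_nhds_unique hleft ?_
  simp_rw [(hsimple _).2]
  exact (Complex.continuous_exp.tendsto _).comp hright

end PoissonFunctional

/-! ### The intensity in flattened coordinates -/

section Intensity

theorem isFiniteMeasureOnCompacts_comap_subtype_val {X : Type*} [TopologicalSpace X]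
    [MeasurableSpace X] [BorelSpace X] (μ : Measure X) [IsFiniteMeasureOnCompacts μ] {s : Set X}
    (hs : MeasurableSet s) :
    IsFiniteMeasureOnCompacts (μ.comap ((↑) : s → X)) :=
  ⟨fun K hK => by
    rw [(MeasurableEmbedding.subtype_coe hs).comap_apply]
    exact (hK.image continuous_subtype_val).measure_lt_top⟩

instance isFiniteMeasureOnCompacts_volume_comap_nnreal :
    IsFiniteMeasureOnCompacts ((volume : Measure ℝ).comap ((↑) : ℝ≥0 → ℝ)) :=
  isFiniteMeasureOnCompacts_comap_subtype_val volume measurableSet_Ici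

instance isFiniteMeasureOnCompacts_volume_comap_Ioi :
    IsFiniteMeasureOnCompacts ((volume : Measure ℝ).comap ((↑) : Set.Ioi (0 : ℝ) → ℝ)) :=
  isFiniteMeasureOnCompacts_comap_subtype_val volume measurableSet_Ioi

instance locallyCompactSpace_Ioi_zero : LocallyCompactSpace (Set.Ioi (0 : ℝ)) :=
  isOpen_Ioi.locallyCompactSpace

/-- The decreasing power `v ↦ v ^ (-b⁻¹)` of a positive real. -/
noncomputable def negPowInv (b : ℝ) (v : Set.Ioi (0 : ℝ)) : Set.Ioi (0 : ℝ) :=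
  ⟨(v : ℝ) ^ (-b⁻¹), Real.rpow_pos_of_pos v.2 _⟩

/-- The homeomorphism `(t, v) ↦ (t, v ^ (-1 / β t))` of the state space. -/
noncomputable def tailHomeomorph {β : ℝ≥0 → ℝ} (hβ : Continuous β) (hpos : ∀ t, 0 < β t) :
    StateSpace ≃ₜ StateSpace where
  toFun p := (p.1, negPowInv (β p.1) p.2)
  invFun p := (p.1, ⟨(p.2 : ℝ) ^ (-β p.1), Real.rpow_pos_of_pos p.2.2 _⟩)
  left_inv p := by
    refine Prod.ext rfl (Subtype.ext ?_)
    change ((p.2 : ℝ) ^ (-(β p.1)⁻¹)) ^ (-β p.1) = p.2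
    rw [← Real.rpow_mul (le_of_lt p.2.2), neg_mul_neg, inv_mul_cancel₀ (hpos _).ne',
      Real.rpow_one]
  right_inv p := by
    refine Prod.ext rfl (Subtype.ext ?_)
    change ((p.2 : ℝ) ^ (-β p.1)) ^ (-(β p.1)⁻¹) = p.2
    rw [← Real.rpow_mul (le_of_lt p.2.2), neg_mul_neg, mul_inv_cancel₀ (hpos _).ne',
      Real.rpow_one]
  continuous_toFun := by
    refine continuous_fst.prodMk (Continuous.subtype_mk ?_ _)
    exact (continuous_subtype_val.comp continuous_snd).rpow
      ((hβ.comp continuous_fst).inv₀ fun p => (hpos _).ne').neg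
      fun p => Or.inl (ne_of_gt p.2.2)
  continuous_invFun := by
    refine continuous_fst.prodMk (Continuous.subtype_mk ?_ _)
    exact (continuous_subtype_val.comp continuous_snd).rpow (hβ.comp continuous_fst).neg
      fun p => Or.inl (ne_of_gt p.2.2)

/-- The substitution `v = x ^ (-b)` on the positive half-line. -/
theorem lintegral_Ioi_rpow_substitution {b : ℝ} (hb : 0 < b) (h : Set.Ioi (0 : ℝ) → ℝ≥0∞) :
    ∫⁻ x, ENNReal.ofReal (b * (x : ℝ) ^ (-b - 1)) * h x
        ∂((volume : Measure ℝ).comap ((↑) : Set.Ioi (0 : ℝ) → ℝ)) =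
      ∫⁻ v, h (negPowInv b v) ∂((volume : Measure ℝ).comap ((↑) : Set.Ioi (0 : ℝ) → ℝ)) := by
  let h' : ℝ → ℝ≥0∞ := fun x => if hx : 0 < x then h ⟨x, hx⟩ else 0
  have himg : (fun x : ℝ => x ^ (-b)) '' Set.Ioi 0 = Set.Ioi 0 := by
    ext v
    refine ⟨?_, fun hv => ⟨v ^ (-b⁻¹), Real.rpow_pos_of_pos hv _, ?_⟩⟩
    · rintro ⟨x, hx, rfl⟩
      exact Real.rpow_pos_of_pos hx _
    · change (v ^ (-b⁻¹)) ^ (-b) = v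
      rw [← Real.rpow_mul (le_of_lt hv), neg_mul_neg, inv_mul_cancel₀ hb.ne', Real.rpow_one]
  have hinv : ∀ x : ℝ, 0 < x → (x ^ (-b)) ^ (-b⁻¹) = x := fun x hx => by
    rw [← Real.rpow_mul hx.le, neg_mul_neg, mul_inv_cancel₀ hb.ne', Real.rpow_one]
  have key := lintegral_image_eq_lintegral_abs_deriv_mul (s := Set.Ioi (0 : ℝ))
    (f := fun x => x ^ (-b)) (f' := fun x => -b * x ^ (-b - 1)) measurableSet_Ioi
    (fun x hx => (Real.hasDerivAt_rpow_const (Or.inl (ne_of_gt hx))).hasDerivWithinAt)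
    (fun x hx y hy hxy => by
      rw [← hinv x hx, ← hinv y hy]
      exact congrArg (· ^ (-b⁻¹)) hxy)
    fun v => h' (v ^ (-b⁻¹))
  rw [himg, ← lintegral_subtype_comap measurableSet_Ioi,
    ← lintegral_subtype_comap measurableSet_Ioi] at key
  refine Eq.trans ?_ (key.symm.trans ?_)
  · refine lintegral_congr fun x => ?_
    have hx : (0 : ℝ) < x := x.2
    rw [hinv x hx, abs_mul, abs_neg, abs_of_pos hb, abs_of_pos (Real.rpow_pos_of_pos hx _)]
    simp [h', hx]
  · refine lintegral_congr fun v => ?_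
    have hv : (0 : ℝ) < (v : ℝ) ^ (-b⁻¹) := Real.rpow_pos_of_pos v.2 _
    simp only [h', dif_pos hv]
    rfl

/-- In the coordinates `(t, v)` with `v = x ^ (-β t)`, the intensity is Lebesgue measure. -/
theorem multistableIntensity_eq_map {β : ℝ≥0 → ℝ} (hβ : Continuous β) (hpos : ∀ t, 0 < β t) :
    multistableIntensity β = Measure.map (tailHomeomorph hβ hpos)
      (((volume : Measure ℝ).comap ((↑) : ℝ≥0 → ℝ)).prod
        ((volume : Measure ℝ).comap ((↑) : Set.Ioi (0 : ℝ) → ℝ))) := by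
  have hdens : Measurable fun p : StateSpace =>
      ENNReal.ofReal (β p.1 * (p.2 : ℝ) ^ (-β p.1 - 1)) := by
    have := hβ.measurable
    fun_prop
  refine Measure.ext_of_lintegral _ fun g hg => ?_
  have hΦ := (tailHomeomorph hβ hpos).continuous.measurable
  rw [multistableIntensity, lintegral_withDensity_eq_lintegral_mul _ hdens hg,
    lintegral_map hg hΦ, lintegral_prod _ (hdens.mul hg).aemeasurable,
    lintegral_prod (fun p => g (tailHomeomorph hβ hpos p)) (hg.comp hΦ).aemeasurable]
  exact lintegral_congr fun t => lintegral_Ioi_rpow_substitution (hpos t) fun x => g (t, x)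

/-- Inherited from Lebesgue measure, because a homeomorphism pulls compact sets back to compact
sets. -/
theorem isFiniteMeasureOnCompacts_multistableIntensity {β : ℝ≥0 → ℝ} (hβ : Continuous β)
    (hpos : ∀ t, 0 < β t) : IsFiniteMeasureOnCompacts (multistableIntensity β) := by
  rw [multistableIntensity_eq_map hβ hpos]
  refine ⟨fun K hK => ?_⟩
  rw [Measure.map_apply (tailHomeomorph hβ hpos).continuous.measurable hK.measurableSet]
  exact ((tailHomeomorph hβ hpos).isCompact_preimage.2 hK).measure_lt_top

theorem integral_multistableIntensity {β : ℝ≥0 → ℝ} (hβ : Continuous β) (hpos : ∀ t, 0 < β t)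
    {g : StateSpace → ℂ} (hg : Continuous g) (hgc : HasCompactSupport g) :
    ∫ p, g p ∂multistableIntensity β =
      ∫ t, (∫ v, g (t, negPowInv (β t) v)
        ∂((volume : Measure ℝ).comap ((↑) : Set.Ioi (0 : ℝ) → ℝ)))
        ∂((volume : Measure ℝ).comap ((↑) : ℝ≥0 → ℝ)) := by
  rw [multistableIntensity_eq_map hβ hpos,
    integral_map (tailHomeomorph hβ hpos).continuous.measurable.aemeasurable
      hg.aestronglyMeasurable]
  exact integral_prod _
    ((hg.comp (tailHomeomorph hβ hpos).continuous).integrable_of_hasCompactSupport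
    (hgc.comp_homeomorph _))

end Intensity

/-! ### Regular variation of the tail -/

section RegularVariation

/-- The tail function `u ^ (-α) L u` is positive on the positive half-line when it is monotone. -/
theorem IsSlowlyVarying.tail_pos {L : ℝ → ℝ} (hL : IsSlowlyVarying L) {α : ℝ}
    (hanti : AntitoneOn (fun u => u ^ (-α) * L u) (Set.Ioi 0))
    (hnonneg : ∀ u, 0 < u → 0 ≤ u ^ (-α) * L u) {u : ℝ} (hu : 0 < u) : 0 < u ^ (-α) * L u := by
  -- Division by zero yields `0`, so `L t / L t → 1` forces `L t ≠ 0` eventually.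
  have h1 : ∀ᶠ t in atTop, L t ≠ 0 := by
    filter_upwards [(hL 1 one_pos).eventually_ne one_ne_zero] with t ht h0
    simp [h0] at ht
  obtain ⟨t, ht, hut⟩ := (h1.and (eventually_ge_atTop u)).exists
  have htpos := hu.trans_le hut
  exact ((hnonneg t htpos).lt_of_ne'
    (mul_ne_zero (Real.rpow_pos_of_pos htpos _).ne' ht)).trans_le (hanti hu htpos hut)

/-- The tail function is positive and nonincreasing, so it is bounded below by a positive constant
on (0, M], while its values at `a n` equal 1/n and tend to 0. -/
theorem IsSlowlyVarying.tendsto_norming_atTop {L : ℝ → ℝ} (hL : IsSlowlyVarying L) {α : ℝ}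
    (hanti : AntitoneOn (fun u => u ^ (-α) * L u) (Set.Ioi 0))
    (hnonneg : ∀ u, 0 < u → 0 ≤ u ^ (-α) * L u) {a : ℕ+ → ℝ} (ha_pos : ∀ n, 0 < a n)
    (ha : ∀ᶠ n : ℕ+ in atTop, a n ^ (-α) * L (a n) = 1 / ((n : ℕ) : ℝ)) :
    Tendsto a atTop atTop := by
  refine tendsto_atTop.2 fun M => ?_
  have hM : (0 : ℝ) < max M 1 := lt_max_of_lt_right one_pos
  have h1 : Tendsto (fun n : ℕ+ => 1 / ((n : ℕ) : ℝ)) atTop (𝓝 0) :=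
    tendsto_one_div_atTop_nhds_zero_nat.comp tendsto_PNat_val_atTop_atTop
  filter_upwards [ha, h1.eventually_lt_const (hL.tail_pos hanti hnonneg hM)] with n hn hlt
  by_contra hlt'
  have := hanti (ha_pos n) hM ((not_le.1 hlt').le.trans (le_max_left _ _))
  simp only at this
  linarith

/-- With n · a_n^(-α) L(a_n) = 1, the expression is y^(-α) times L(y a_n) / L(a_n). -/
theorem IsSlowlyVarying.tendsto_mul_tail {L : ℝ → ℝ} (hL : IsSlowlyVarying L) {α : ℝ}
    (hanti : AntitoneOn (fun u => u ^ (-α) * L u) (Set.Ioi 0))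
    (hnonneg : ∀ u, 0 < u → 0 ≤ u ^ (-α) * L u) {a : ℕ+ → ℝ} (ha_pos : ∀ n, 0 < a n)
    (ha : ∀ᶠ n : ℕ+ in atTop, a n ^ (-α) * L (a n) = 1 / ((n : ℕ) : ℝ)) {y : ℝ} (hy : 0 < y) :
    Tendsto (fun n : ℕ+ => ((n : ℕ) : ℝ) * ((y * a n) ^ (-α) * L (y * a n))) atTop
      (𝓝 (y ^ (-α))) := by
  have h1 := ((hL y hy).comp
    (hL.tendsto_norming_atTop hanti hnonneg ha_pos ha)).const_mul (y ^ (-α))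
  rw [mul_one] at h1
  refine h1.congr' ?_
  filter_upwards [ha] with n hn
  have hn0 : ((n : ℕ) : ℝ) ≠ 0 := by exact_mod_cast n.ne_zero
  have han : 0 < a n ^ (-α) := Real.rpow_pos_of_pos (ha_pos n) _
  have hLn : L (a n) ≠ 0 := fun h0 => by
    rw [h0, mul_zero] at hn
    exact one_div_ne_zero hn0 hn.symm
  rw [Real.mul_rpow hy.le (ha_pos n).le, Function.comp_apply]
  field_simp at hn ⊢
  linear_combination (-(L (y * a n))) * hn

end RegularVariation

/-! ### Riemann–Stieltjes sums and step functions -/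

section Quadrature

/-- Error bound for Riemann–Stieltjes sums on the positive half-line. -/
theorem norm_setIntegral_sub_riemannSum_le {μ : Measure (Set.Ioi (0 : ℝ))}
    (hμ : ∀ v : ℝ, μ {x | (x : ℝ) < v} ≠ ∞)
    {h : Set.Ioi (0 : ℝ) → ℂ} (hi : Integrable h μ) {δ ε : ℝ} (hδ : 0 < δ)
    (hh : ∀ x y, dist x y ≤ δ → ‖h x - h y‖ ≤ ε) (p : ℕ → Set.Ioi (0 : ℝ))
    (hp : ∀ j, (p j : ℝ) = (j + 1) * δ) (N : ℕ) :
    ‖∫ x in {x | (x : ℝ) < N * δ}, h x ∂μ -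
      ∑ j ∈ Finset.range N, ((μ.real {x | (x : ℝ) < (j + 1) * δ} -
        μ.real {x | (x : ℝ) < j * δ} : ℝ) : ℂ) * h (p j)‖ ≤
      ε * μ.real {x | (x : ℝ) < N * δ} := by
  have hmeas : ∀ v : ℝ, MeasurableSet {x : Set.Ioi (0 : ℝ) | (x : ℝ) < v} := fun v =>
    measurableSet_lt measurable_subtype_coe measurable_const
  induction N with
  | zero =>
    have : {x : Set.Ioi (0 : ℝ) | (x : ℝ) < (0 : ℕ) * δ} = ∅ := by
      ext x
      simpa using le_of_lt x.2
    rw [this]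
    simp
  | succ N ih =>
    let A : Set (Set.Ioi (0 : ℝ)) := {x | (x : ℝ) < N * δ}
    let B : Set (Set.Ioi (0 : ℝ)) := {x | (x : ℝ) < (N + 1) * δ}
    have hAB : A ⊆ B := fun x (hx : (x : ℝ) < N * δ) => by
      change (x : ℝ) < (N + 1) * δ
      linarith
    -- Only the last cell `B \ A` is new; on it `h` is within `ε` of its value at the right endpoint
    -- `p N`.
    have hsplit : ∫ x in B, h x ∂μ = ∫ x in A, h x ∂μ + ∫ x in B \ A, h x ∂μ := by
      rw [← setIntegral_union Set.disjoint_sdiff_right ((hmeas _).diff (hmeas _))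
        hi.integrableOn hi.integrableOn, Set.union_sdiff_cancel hAB]
    have hreal : μ.real (B \ A) = μ.real B - μ.real A :=
      measureReal_sdiff hAB (hmeas _) (hμ _)
    have hfin : μ (B \ A) < ∞ := (measure_mono Set.sdiff_subset).trans_lt (hμ _).lt_top
    have hlast : ‖∫ x in B \ A, h x ∂μ - ((μ.real B - μ.real A : ℝ) : ℂ) * h (p N)‖ ≤
        ε * (μ.real B - μ.real A) := by
      have hc : ∫ _ in B \ A, h (p N) ∂μ = ((μ.real B - μ.real A : ℝ) : ℂ) * h (p N) := by
        rw [setIntegral_const, hreal, Complex.real_smul]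
      rw [← hc, ← integral_sub hi.integrableOn (integrableOn_const hfin.ne), ← hreal]
      refine norm_setIntegral_le_of_norm_le_const hfin fun x hx => hh _ _ ?_
      have h1 : (x : ℝ) < (N + 1) * δ := hx.1
      have h2 : N * δ ≤ (x : ℝ) := not_lt.1 hx.2
      rw [Subtype.dist_eq, hp, Real.dist_eq, abs_le]
      constructor <;> linarith
    rw [Finset.sum_range_succ]
    push_cast at ih hlast ⊢
    change ‖∫ x in B, h x ∂μ - _‖ ≤ ε * μ.real B
    rw [hsplit]
    calc _ = ‖_ + _‖ := by rw [add_sub_add_comm]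
      _ ≤ _ := norm_add_le _ _
      _ ≤ ε * μ.real A + ε * (μ.real B - μ.real A) := add_le_add ih hlast
      _ = ε * μ.real B := by ring

theorem volume_real_comap_Ioi_setOf_lt {v : ℝ} (hv : 0 ≤ v) :
    ((volume : Measure ℝ).comap ((↑) : Set.Ioi (0 : ℝ) → ℝ)).real {x | (x : ℝ) < v} = v := by
  rw [measureReal_def, (MeasurableEmbedding.subtype_coe measurableSet_Ioi).comap_apply]
  have : ((↑) : Set.Ioi (0 : ℝ) → ℝ) '' {x | (x : ℝ) < v} = Set.Ioo 0 v := by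
    ext x
    constructor
    · rintro ⟨y, hy, rfl⟩
      exact ⟨y.2, hy⟩
    · exact fun hx => ⟨⟨x, hx.1⟩, hx.2, rfl⟩
  rw [this, Real.volume_Ioo, sub_zero, ENNReal.toReal_ofReal hv]

theorem volume_comap_Ioi_setOf_lt_ne_top (v : ℝ) :
    ((volume : Measure ℝ).comap ((↑) : Set.Ioi (0 : ℝ) → ℝ)) {x | (x : ℝ) < v} ≠ ∞ := by
  rw [(MeasurableEmbedding.subtype_coe measurableSet_Ioi).comap_apply]
  refine ne_top_of_le_ne_top (measure_Ioo_lt_top (a := (0 : ℝ)) (b := v)).ne (measure_mono ?_)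
  rintro _ ⟨y, hy, rfl⟩
  exact ⟨y.2, hy⟩

/-- If the distribution functions of finite measures on the positive half-line converge to that of
Lebesgue measure, then so do the integrals of continuous functions with compact support. -/
theorem tendsto_integral_of_tendsto_measure_setOf_lt {κ : Type*} {l : Filter κ}
    {μ : κ → Measure (Set.Ioi (0 : ℝ))} [∀ n, IsFiniteMeasure (μ n)]
    (hμ : ∀ v : ℝ, 0 < v → Tendsto (fun n => (μ n).real {x | (x : ℝ) < v}) l (𝓝 v))
    {h : Set.Ioi (0 : ℝ) → ℂ} (hc : Continuous h) (hs : HasCompactSupport h) :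
    Tendsto (fun n => ∫ x, h x ∂μ n) l
      (𝓝 (∫ x, h x ∂((volume : Measure ℝ).comap ((↑) : Set.Ioi (0 : ℝ) → ℝ)))) := by
  set lam := (volume : Measure ℝ).comap ((↑) : Set.Ioi (0 : ℝ) → ℝ) with hlam
  have huc := hs.uniformContinuous_of_continuous hc
  obtain ⟨d₀, hd₀⟩ := (hs.isCompact.image continuous_subtype_val).bddAbove
  set d := max d₀ 0 with hd
  have hd0 : 0 ≤ d := le_max_right _ _
  rw [Metric.tendsto_nhds]
  intro η hη
  -- The mass below `N * δ` is at most `d + 1` for Lebesgue measure and eventually less than `d + 2`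
  -- for `μ n`. Each quadrature error is thus at most `η / 4`, and the Riemann sums differ by less
  -- than `η / 4`.
  set ε := η / (4 * (d + 2)) with hε
  have hεpos : 0 < ε := by positivity
  obtain ⟨δ₀, hδ₀, hosc⟩ := Metric.uniformContinuous_iff.1 huc ε hεpos
  set δ := min (δ₀ / 2) 1 with hδ
  have hδpos : 0 < δ := lt_min (half_pos hδ₀) one_pos
  have hδ1 : δ ≤ 1 := min_le_right _ _
  have hosc' : ∀ x y, dist x y ≤ δ → ‖h x - h y‖ ≤ ε := fun x y hxy => by
    rw [← dist_eq_norm]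
    exact (hosc (hxy.trans_lt ((min_le_left _ _).trans_lt (half_lt_self hδ₀)))).le
  set N := ⌊d / δ⌋₊ + 1 with hN
  have hNd : d < N * δ := by
    rw [← div_lt_iff₀ hδpos, hN]
    exact_mod_cast Nat.lt_floor_add_one _
  have hNd' : N * δ ≤ d + 1 := by
    have : (⌊d / δ⌋₊ : ℝ) ≤ d / δ := Nat.floor_le (by positivity)
    rw [le_div_iff₀ hδpos] at this
    rw [hN]
    push_cast
    linarith
  let p : ℕ → Set.Ioi (0 : ℝ) := fun j =>
    ⟨(j + 1) * δ, mul_pos (by positivity : (0 : ℝ) < j + 1) hδpos⟩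
  have hvanish : ∀ m : Measure (Set.Ioi (0 : ℝ)),
      ∫ x in {x | (x : ℝ) < N * δ}, h x ∂m = ∫ x, h x ∂m := by
    intro m
    refine setIntegral_eq_integral_of_forall_compl_eq_zero fun x hx => ?_
    by_contra h0
    have h1 : (x : ℝ) ≤ d₀ := hd₀ ⟨x, subset_tsupport _ h0, rfl⟩
    exact hx ((h1.trans (le_max_left _ _)).trans_lt hNd)
  let S : Measure (Set.Ioi (0 : ℝ)) → ℂ := fun m => ∑ j ∈ Finset.range N,
    ((m.real {x | (x : ℝ) < (j + 1) * δ} - m.real {x | (x : ℝ) < j * δ} : ℝ) : ℂ) * h (p j)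
  have hbound : ∀ m : Measure (Set.Ioi (0 : ℝ)), (∀ v : ℝ, m {x | (x : ℝ) < v} ≠ ∞) →
      Integrable h m → ‖∫ x, h x ∂m - S m‖ ≤ ε * m.real {x | (x : ℝ) < N * δ} := by
    intro m hm hi
    rw [← hvanish m]
    exact norm_setIntegral_sub_riemannSum_le hm hi hδpos hosc' p (fun j => rfl) N
  have hF : ∀ v : ℝ, 0 ≤ v → Tendsto (fun n => (μ n).real {x | (x : ℝ) < v}) l
      (𝓝 (lam.real {x | (x : ℝ) < v})) := by
    intro v hv
    rw [volume_real_comap_Ioi_setOf_lt hv]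
    rcases hv.eq_or_lt with rfl | hv
    · have : {x : Set.Ioi (0 : ℝ) | (x : ℝ) < 0} = ∅ := by
        ext x
        simpa using le_of_lt x.2
      simpa [this] using tendsto_const_nhds
    · exact hμ v hv
  have hS : Tendsto (fun n => S (μ n)) l (𝓝 (S lam)) := by
    refine tendsto_finsetSum _ fun j _ => Tendsto.mul_const _ ?_
    exact (Complex.continuous_ofReal.tendsto _).comp
      ((hF _ (by positivity)).sub (hF _ (by positivity)))
  have hNpos : 0 ≤ N * δ := by positivity
  have hlamN := volume_real_comap_Ioi_setOf_lt hNpos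
  have hlam_bound := hbound lam volume_comap_Ioi_setOf_lt_ne_top
    (hc.integrable_of_hasCompactSupport hs)
  rw [← hlam] at hlamN
  rw [hlamN] at hlam_bound
  have hFN := hF _ hNpos
  rw [hlamN] at hFN
  filter_upwards [Metric.tendsto_nhds.1 hS (η / 4) (by positivity),
    hFN.eventually_lt_const (show N * δ < d + 2 by linarith)] with n h1 h2
  have h3 := hbound (μ n) (fun v => measure_ne_top _ _) (hc.integrable_of_hasCompactSupport hs)
  rw [dist_eq_norm] at h1 ⊢
  have hεd : ε * (d + 2) = η / 4 := by
    rw [hε]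
    field_simp
  have h4 : ε * (μ n).real {x | (x : ℝ) < N * δ} ≤ η / 4 := by
    rw [← hεd]
    gcongr
  have h5 : ε * (N * δ) ≤ η / 4 := by
    rw [← hεd]
    gcongr
    linarith
  calc ‖∫ x, h x ∂μ n - ∫ x, h x ∂lam‖
      = ‖(∫ x, h x ∂μ n - S (μ n)) + (S (μ n) - S lam) - (∫ x, h x ∂lam - S lam)‖ := by
        congr 1
        ring
    _ ≤ ‖∫ x, h x ∂μ n - S (μ n)‖ + ‖S (μ n) - S lam‖ + ‖∫ x, h x ∂lam - S lam‖ :=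
        (norm_sub_le _ _).trans (by gcongr; exact norm_add_le _ _)
    _ < η := by linarith

/-- Sums as integrals of step functions. -/
theorem integral_comp_floor_mul {n : ℕ} (hn : 0 < n) {φ : ℕ → ℂ} {N : ℕ}
    (hφ : ∀ j, N ≤ j → φ j = 0) :
    ∫ t, φ ⌊(n : ℝ≥0) * t⌋₊ ∂((volume : Measure ℝ).comap ((↑) : ℝ≥0 → ℝ)) =
      (n : ℂ)⁻¹ * ∑ j ∈ Finset.range N, φ j := by
  set lam := (volume : Measure ℝ).comap ((↑) : ℝ≥0 → ℝ)
  have hn' : (0 : ℝ) < n := by exact_mod_cast hn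
  let I : ℕ → Set ℝ≥0 := fun j => {t | ⌊(n : ℝ≥0) * t⌋₊ = j}
  have hI : ∀ j, MeasurableSet (I j) := fun j =>
    (Nat.measurable_floor.comp (measurable_const_mul _)) (measurableSet_singleton j)
  have hvol : ∀ j, lam (I j) = ENNReal.ofReal (n : ℝ)⁻¹ := by
    intro j
    have himg : ((↑) : ℝ≥0 → ℝ) '' I j = Set.Ico ((j : ℝ) / n) ((j + 1) / n) := by
      ext x
      constructor
      · rintro ⟨t, ht, rfl⟩
        have ht' : ⌊(n : ℝ≥0) * t⌋₊ = j := ht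
        rw [Nat.floor_eq_iff (by positivity)] at ht'
        obtain ⟨h1, h2⟩ := ht'
        have h1' : (j : ℝ) ≤ n * t := by exact_mod_cast h1
        have h2' : (n : ℝ) * t < j + 1 := by exact_mod_cast h2
        rw [Set.mem_Ico, div_le_iff₀ hn', lt_div_iff₀ hn']
        constructor <;> linarith
      · rintro ⟨h1, h2⟩
        rw [div_le_iff₀ hn'] at h1
        rw [lt_div_iff₀ hn'] at h2
        have hx : 0 ≤ x := by
          by_contra hx
          have : x * n < 0 := mul_neg_of_neg_of_pos (not_le.1 hx) hn'
          have : (0 : ℝ) ≤ j := by positivity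
          linarith
        lift x to ℝ≥0 using hx
        refine ⟨x, ?_, rfl⟩
        change ⌊(n : ℝ≥0) * x⌋₊ = j
        rw [Nat.floor_eq_iff (by positivity), ← NNReal.coe_le_coe, ← NNReal.coe_lt_coe]
        push_cast
        constructor <;> linarith
    have hemb : MeasurableEmbedding ((↑) : ℝ≥0 → ℝ) :=
      MeasurableEmbedding.subtype_coe measurableSet_Ici
    rw [hemb.comap_apply, himg]
    rw [Real.volume_Ico, ← sub_div, add_sub_cancel_left, one_div]
  have hfun : ∀ t : ℝ≥0, φ ⌊(n : ℝ≥0) * t⌋₊ =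
      ∑ j ∈ Finset.range N, (I j).indicator (fun _ => φ j) t := by
    intro t
    by_cases ht : ⌊(n : ℝ≥0) * t⌋₊ < N
    · rw [Finset.sum_eq_single_of_mem _ (Finset.mem_range.2 ht)]
      · rw [Set.indicator_of_mem (show t ∈ I _ from rfl)]
      · exact fun j _ hj => Set.indicator_of_notMem (fun h => hj (Eq.symm h)) _
    · rw [hφ _ (not_lt.1 ht), Finset.sum_eq_zero]
      exact fun j hj => Set.indicator_of_notMem
        (fun h => ht (lt_of_eq_of_lt h (Finset.mem_range.1 hj))) _
  simp_rw [hfun]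
  rw [integral_finsetSum _ fun j _ =>
    (integrable_indicator_iff (hI j)).2 (integrableOn_const (by simp [hvol])), Finset.mul_sum]
  refine Finset.sum_congr rfl fun j _ => ?_
  rw [integral_indicator_const _ (hI j), measureReal_def, hvol,
    ENNReal.toReal_ofReal (inv_nonneg.2 hn'.le), Complex.real_smul]
  push_cast
  rfl

end Quadrature

/-! ### Products of null arrays -/

section NullArrays

/-- Factors are exchanged one at a time; all the remaining ones have norm at most 1. -/
theorem norm_prod_sub_prod_le_sum {ι : Type*} (s : Finset ι) {u w : ι → ℂ}
    (hu : ∀ i ∈ s, ‖u i‖ ≤ 1) (hw : ∀ i ∈ s, ‖w i‖ ≤ 1) :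
    ‖∏ i ∈ s, u i - ∏ i ∈ s, w i‖ ≤ ∑ i ∈ s, ‖u i - w i‖ := by
  classical
  induction s using Finset.induction_on with
  | empty => simp
  | insert a s ha ih =>
    have ih' := ih (fun i hi => hu i (Finset.mem_insert_of_mem hi))
      fun i hi => hw i (Finset.mem_insert_of_mem hi)
    have hua := hu a (Finset.mem_insert_self a s)
    have hws : ‖∏ i ∈ s, w i‖ ≤ 1 := by
      rw [norm_prod]
      exact Finset.prod_le_one (fun _ _ => norm_nonneg _)
        fun i hi => hw i (Finset.mem_insert_of_mem hi)
    rw [Finset.prod_insert ha, Finset.prod_insert ha, Finset.sum_insert ha]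
    calc ‖u a * ∏ i ∈ s, u i - w a * ∏ i ∈ s, w i‖
        = ‖u a * (∏ i ∈ s, u i - ∏ i ∈ s, w i) + (u a - w a) * ∏ i ∈ s, w i‖ := by
          congr 1
          ring
      _ ≤ ‖u a‖ * ‖∏ i ∈ s, u i - ∏ i ∈ s, w i‖ + ‖u a - w a‖ * ‖∏ i ∈ s, w i‖ := by
          rw [← norm_mul, ← norm_mul]
          exact norm_add_le _ _
      _ ≤ 1 * ∑ i ∈ s, ‖u i - w i‖ + ‖u a - w a‖ * 1 := by gcongr
      _ = ‖u a - w a‖ + ∑ i ∈ s, ‖u i - w i‖ := by ring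

/-- Products of a null array of complex numbers with bounded row products. -/
theorem tendsto_prod_one_add_of_tendsto_sum {κ : Type*} {l : Filter κ} {z : κ → ℕ → ℂ}
    {N : κ → ℕ} {c : κ → ℝ} {Z : ℂ}
    (hsum : Tendsto (fun n => ∑ j ∈ Finset.range (N n), z n j) l (𝓝 Z))
    (hone : ∀ n j, ‖1 + z n j‖ ≤ 1) (hz : ∀ᶠ n in l, ∀ j, ‖z n j‖ ≤ c n)
    (hc : Tendsto c l (𝓝 0)) (hNc : Tendsto (fun n => (N n : ℝ) * c n ^ 2) l (𝓝 0)) :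
    Tendsto (fun n => ∏ j ∈ Finset.range (N n), (1 + z n j)) l (𝓝 (Complex.exp Z)) := by
  have hexp : Tendsto (fun n => ∏ j ∈ Finset.range (N n), Complex.exp (z n j)) l
      (𝓝 (Complex.exp Z)) := by
    simp_rw [← Complex.exp_sum]
    exact (Complex.continuous_exp.tendsto _).comp hsum
  -- The bound `‖1 + z‖ ≤ 1` forces the real part of `z` to be nonpositive.
  have hre : ∀ n j, ‖Complex.exp (z n j)‖ ≤ 1 := by
    intro n j
    rw [Complex.norm_exp, Real.exp_le_one_iff]
    have := (Complex.re_le_norm _).trans (hone n j)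
    rw [Complex.add_re, Complex.one_re] at this
    linarith
  have hdiff : Tendsto (fun n => ∏ j ∈ Finset.range (N n), (1 + z n j) -
      ∏ j ∈ Finset.range (N n), Complex.exp (z n j)) l (𝓝 0) := by
    refine squeeze_zero_norm' ?_ hNc
    filter_upwards [hz, hc.eventually_le_const one_pos] with n hn hc1
    refine (norm_prod_sub_prod_le_sum _ (fun j _ => hone n j) fun j _ => hre n j).trans ?_
    refine (Finset.sum_le_card_nsmul _ _ (c n ^ 2) fun j _ => ?_).trans_eq (by simp)
    rw [norm_sub_rev, ← sub_sub]
    refine (Complex.norm_exp_sub_one_sub_id_le ((hn j).trans hc1)).trans ?_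
    exact pow_le_pow_left₀ (norm_nonneg _) (hn j) 2
  simpa using hdiff.add hexp

end NullArrays

/-! ### Integrals against a row of points -/

section RowIntegrals

/-- A function on the state space evaluated at `(t, y)`, with value zero if `y ≤ 0`. -/
noncomputable def evalPos {F : Type*} [Zero F] (g : StateSpace → F) (t : ℝ≥0) (y : ℝ) : F :=
  open Classical in if h : 0 < y then g (t, ⟨y, h⟩) else 0

theorem evalPos_of_pos {F : Type*} [Zero F] (g : StateSpace → F) (t : ℝ≥0) {y : ℝ} (h : 0 < y) :
    evalPos g t y = g (t, ⟨y, h⟩) := dif_pos h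

theorem evalPos_of_not_pos {F : Type*} [Zero F] (g : StateSpace → F) (t : ℝ≥0) {y : ℝ}
    (h : ¬ 0 < y) : evalPos g t y = 0 := dif_neg h

theorem measurable_evalPos {F : Type*} [Zero F] [MeasurableSpace F] {g : StateSpace → F}
    (hg : Measurable g) (t : ℝ≥0) : Measurable (evalPos g t) := by
  refine Measurable.dite (s := {y : ℝ | 0 < y}) (f := fun y => g (t, ⟨y, y.2⟩)) (g := fun _ => 0)
    ?_ measurable_const measurableSet_Ioi
  exact hg.comp (measurable_const.prodMk measurable_id)

theorem integral_rowPointMeasure {f : StateSpace → ℝ} (hf : Continuous f)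
    (hfc : HasCompactSupport f) {n : ℕ+} {N : ℕ}
    (hN : ∀ j : ℕ, N ≤ j → ∀ x, f (gridTime n j.succPNat, x) = 0) (y : ℕ+ → ℝ) :
    ∫ p, f p ∂(rowPointMeasure n y).toMeasure =
      ∑ j ∈ Finset.range N, evalPos f (gridTime n j.succPNat) (y j.succPNat) := by
  have hi := (rowPointMeasure n y).integrable_of_hasCompactSupport hf hfc
  have h1 : HasSum (fun k : {k : ℕ+ // 0 < y k} => f (gridTime n k, ⟨y k, k.2⟩))
      (∫ p, f p ∂(rowPointMeasure n y).toMeasure) := by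
    have h0 := hasSum_integral_measure hi
    simp only [integral_dirac] at h0
    exact h0
  have h2 : HasSum (fun k : ℕ+ => evalPos f (gridTime n k) (y k))
      (∫ p, f p ∂(rowPointMeasure n y).toMeasure) := by
    have hsub : Function.support (fun k : ℕ+ => evalPos f (gridTime n k) (y k)) ⊆
        {k | 0 < y k} := by
      intro k hk
      by_contra h
      exact hk (evalPos_of_not_pos _ _ h)
    rw [← hasSum_subtype_iff_of_support_subset hsub]
    exact h1.congr_fun fun k => evalPos_of_pos f _ k.2
  have h3 := (Equiv.pnatEquivNat.symm.hasSum_iff (f := fun k : ℕ+ =>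
    evalPos f (gridTime n k) (y k))).2 h2
  refine h3.unique ?_
  refine hasSum_sum_of_ne_finset_zero fun j hj => ?_
  rw [Finset.mem_range, not_lt] at hj
  change evalPos f (gridTime n j.succPNat) (y j.succPNat) = 0
  by_cases h : 0 < y j.succPNat
  · rw [evalPos_of_pos _ _ h, hN j hj]
  · exact evalPos_of_not_pos _ _ h

theorem gridTime_succPNat (n : ℕ+) (j : ℕ) :
    gridTime n j.succPNat = ((j : ℝ≥0) + 1) / ((n : ℕ) : ℝ≥0) := by
  simp [gridTime]

/-- Index `j` stands for k = j + 1, so j ≥ T n already puts the time point strictly beyond T. -/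
theorem eq_zero_of_ceil_le {F : Type*} [Zero F] {f : StateSpace → F} {T : ℝ≥0}
    (hT : ∀ p, f p ≠ 0 → p.1 ≤ T) {n : ℕ+} {j : ℕ} (hj : ⌈T * ((n : ℕ) : ℝ≥0)⌉₊ ≤ j)
    (x : Set.Ioi (0 : ℝ)) : f (gridTime n j.succPNat, x) = 0 := by
  have hn : (0 : ℝ≥0) < ((n : ℕ) : ℝ≥0) := by exact_mod_cast n.pos
  by_contra h
  have h1 : gridTime n j.succPNat ≤ T := hT _ h
  rw [gridTime_succPNat, div_le_iff₀ hn] at h1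
  have h2 : T * ((n : ℕ) : ℝ≥0) ≤ j := (Nat.le_ceil _).trans (by exact_mod_cast hj)
  exact absurd (h1.trans h2) (not_le.2 (lt_add_one _))

theorem exists_bound_fst {F : Type*} [Zero F] {f : StateSpace → F} (hf : HasCompactSupport f) :
    ∃ T : ℝ≥0, ∀ p, f p ≠ 0 → p.1 ≤ T := by
  obtain ⟨T, hT⟩ := (hf.isCompact.image continuous_fst).bddAbove
  exact ⟨T, fun p hp => hT ⟨p, subset_tsupport _ hp, rfl⟩⟩

theorem exists_bound_snd {F : Type*} [Zero F] {f : StateSpace → F} (hf : HasCompactSupport f) :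
    ∃ d : ℝ, 0 < d ∧ ∀ p, f p ≠ 0 → (p.2 : ℝ) < d := by
  obtain ⟨d, hd⟩ := (hf.isCompact.image (continuous_subtype_val.comp continuous_snd)).bddAbove
  refine ⟨max d 0 + 1, by positivity, fun p hp => ?_⟩
  have h1 : (p.2 : ℝ) ≤ d := hd ⟨p, subset_tsupport _ hp, rfl⟩
  linarith [le_max_left d 0]

/-- By second countability it is enough to test against integrals, each of which is a finite sum of
measurable terms. -/
theorem measurable_rowPointMeasure {Ω : Type*} [MeasurableSpace Ω] {n : ℕ+} {Y : ℕ+ → Ω → ℝ}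
    (hY : ∀ k, Measurable (Y k)) : Measurable fun ω => rowPointMeasure n fun k => Y k ω := by
  refine measurable_of_isInducing_pi (φ := fun (μ : PointMeasure StateSpace)
    (f : C_c(StateSpace, ℝ)) => ∫ x, f x ∂μ.toMeasure) ⟨rfl⟩ fun f => ?_
  obtain ⟨T, hT⟩ := exists_bound_fst f.hasCompactSupport
  refine Eq.mpr (congrArg Measurable (funext fun ω => integral_rowPointMeasure f.continuous
    f.hasCompactSupport (fun j hj x => eq_zero_of_ceil_le hT hj x) fun k => Y k ω)) ?_
  exact Finset.measurable_fun_sum _ fun j _ =>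
    (measurable_evalPos f.continuous.measurable _).comp (hY _)

end RowIntegrals

/-! ### Law of one point in the flattened coordinate -/

section CellMeasures

variable {Ω : Type*} [MeasurableSpace Ω] {P : Measure Ω} {Y : Ω → ℝ} {b : ℝ}

/-- The power `y ^ (-b)` as a positive real, with value `1` if `y ≤ 0`. -/
noncomputable def negPowPos (b y : ℝ) : Set.Ioi (0 : ℝ) :=
  -- The value `1` is arbitrary: `cellMeasure` is restricted to the event where `Y` is positive.
  open Classical in if h : 0 < y then ⟨y ^ (-b), Real.rpow_pos_of_pos h _⟩
    else ⟨1, Set.mem_Ioi.2 one_pos⟩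

theorem measurable_negPowPos (b : ℝ) : Measurable (negPowPos b) := by
  refine Measurable.dite (s := {y : ℝ | 0 < y})
    (f := fun y => (⟨(y : ℝ) ^ (-b), Real.rpow_pos_of_pos y.2 _⟩ : Set.Ioi (0 : ℝ)))
    (g := fun _ => ⟨1, Set.mem_Ioi.2 one_pos⟩) ?_ measurable_const measurableSet_Ioi
  exact Measurable.subtype_mk (by fun_prop)

theorem negPowInv_negPowPos (hb : 0 < b) {y : ℝ} (hy : 0 < y) :
    negPowInv b (negPowPos b y) = ⟨y, hy⟩ := by
  refine Subtype.ext ?_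
  simp only [negPowPos, dif_pos hy, negPowInv]
  rw [← Real.rpow_mul hy.le, neg_mul_neg, mul_inv_cancel₀ hb.ne', Real.rpow_one]

/-- The distribution of `Y ^ (-b)` on the event that `Y` is positive. -/
noncomputable def cellMeasure (b : ℝ) (Y : Ω → ℝ) (P : Measure Ω) : Measure (Set.Ioi (0 : ℝ)) :=
  (P.restrict {ω | 0 < Y ω}).map fun ω => negPowPos b (Y ω)

instance isFiniteMeasure_cellMeasure [IsFiniteMeasure P] :
    IsFiniteMeasure (cellMeasure b Y P) := by
  unfold cellMeasure
  infer_instance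

theorem integral_evalPos_eq_integral_cellMeasure (hY : Measurable Y) (hb : 0 < b)
    {g : StateSpace → ℂ} (hg : Measurable g) (t : ℝ≥0) :
    ∫ ω, evalPos g t (Y ω) ∂P = ∫ v, g (t, negPowInv b v) ∂cellMeasure b Y P := by
  have hm : Measurable fun v => g (t, negPowInv b v) :=
    hg.comp (measurable_const.prodMk (Measurable.subtype_mk (by fun_prop)))
  have hset : MeasurableSet {ω | 0 < Y ω} := measurableSet_lt measurable_const hY
  have hW : Measurable fun ω => negPowPos b (Y ω) := (measurable_negPowPos b).comp hY
  rw [cellMeasure, integral_map hW.aemeasurable hm.aestronglyMeasurable,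
    ← setIntegral_eq_integral_of_forall_compl_eq_zero
    (s := {ω | 0 < Y ω}) (fun ω hω => evalPos_of_not_pos g t hω)]
  refine setIntegral_congr_fun hset fun ω hω => ?_
  have hω' : 0 < Y ω := hω
  simp only [negPowInv_negPowPos hb hω', evalPos_of_pos g t hω']

/-- The map y ↦ y^(-b) reverses order, so a distribution function in v is a tail of `Y`. -/
theorem cellMeasure_real_setOf_lt (hY : Measurable Y) (hb : 0 < b) {v : ℝ} (hv : 0 < v) :
    (cellMeasure b Y P).real {x | (x : ℝ) < v} = P.real {ω | v ^ (-b⁻¹) < Y ω} := by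
  have hmv : MeasurableSet {x : Set.Ioi (0 : ℝ) | (x : ℝ) < v} :=
    measurableSet_lt measurable_subtype_coe measurable_const
  have hm := (measurable_negPowPos b).comp hY
  rw [cellMeasure, measureReal_def, measureReal_def]
  congr 1
  refine (Measure.map_apply hm hmv).trans ?_
  rw [Measure.restrict_apply (hm hmv)]
  congr 1
  ext ω
  have hw : 0 < v ^ (-b⁻¹) := Real.rpow_pos_of_pos hv _
  have hvw : (v ^ (-b⁻¹)) ^ (-b) = v := by
    rw [← Real.rpow_mul hv.le, neg_mul_neg, inv_mul_cancel₀ hb.ne', Real.rpow_one]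
  have hiff : ∀ h : 0 < Y ω, ((negPowPos b (Y ω) : ℝ) < v ↔ v ^ (-b⁻¹) < Y ω) := by
    intro h
    simp only [negPowPos, dif_pos h]
    conv_lhs => rw [← hvw]
    exact Real.rpow_lt_rpow_iff_of_neg h hw (neg_lt_zero.2 hb)
  constructor
  · rintro ⟨h1, h2⟩
    exact (hiff h2).1 h1
  · intro h
    have h0 : 0 < Y ω := hw.trans h
    exact ⟨(hiff h0).2 h, h0⟩

/-- Convergence of integrals along converging sections of a continuous function with compact
support on the state space. -/
theorem tendsto_integral_section {κ : Type*} {l : Filter κ} {μ : κ → Measure (Set.Ioi (0 : ℝ))}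
    [∀ n, IsFiniteMeasure (μ n)]
    (hμ : ∀ v : ℝ, 0 < v → Tendsto (fun n => (μ n).real {x | (x : ℝ) < v}) l (𝓝 v))
    {g : StateSpace → ℂ} (hg : Continuous g) (hgc : HasCompactSupport g) {s : κ → ℝ≥0} {t : ℝ≥0}
    (hs : Tendsto s l (𝓝 t)) :
    Tendsto (fun n => ∫ v, g (s n, v) ∂μ n) l
      (𝓝 (∫ v, g (t, v) ∂((volume : Measure ℝ).comap ((↑) : Set.Ioi (0 : ℝ) → ℝ)))) := by
  have hsec : ∀ r : ℝ≥0, Continuous fun v => g (r, v) := fun r =>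
    hg.comp (continuous_const.prodMk continuous_id)
  have hsecc : ∀ r : ℝ≥0, HasCompactSupport fun v => g (r, v) := fun r =>
    HasCompactSupport.intro (hgc.isCompact.image continuous_snd) fun v hv => by
      by_contra h
      exact hv ⟨(r, v), subset_tsupport _ h, rfl⟩
  have hint : ∀ r n, Integrable (fun v => g (r, v)) (μ n) := fun r n =>
    (hsec r).integrable_of_hasCompactSupport (hsecc r)
  have hmain := tendsto_integral_of_tendsto_measure_setOf_lt hμ (hsec t) (hsecc t)
  obtain ⟨d, hd0, hd⟩ := exists_bound_snd hgc
  have huc := hgc.uniformContinuous_of_continuous hg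
  -- Moving the section from `s n` to `t` costs at most `η / (d + 1)` per unit of mass, and the mass
  -- below `d` is eventually less than `d + 1`.
  have herr : Tendsto (fun n => ∫ v, g (s n, v) ∂μ n - ∫ v, g (t, v) ∂μ n) l (𝓝 0) := by
    rw [Metric.tendsto_nhds]
    intro η hη
    obtain ⟨δ, hδ, hosc⟩ := Metric.uniformContinuous_iff.1 huc (η / (d + 1)) (by positivity)
    filter_upwards [Metric.tendsto_nhds.1 hs δ hδ,
      (hμ d hd0).eventually_lt_const (lt_add_one d)] with n h1 h2
    rw [dist_zero_right, ← integral_sub (hint _ _) (hint _ _),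
      ← setIntegral_eq_integral_of_forall_compl_eq_zero (s := {x : Set.Ioi (0 : ℝ) | (x : ℝ) < d})]
    · refine (norm_setIntegral_le_of_norm_le_const (C := η / (d + 1)) (measure_lt_top _ _)
        fun v _ => ?_).trans_lt ?_
      · rw [← dist_eq_norm]
        refine (hosc ?_).le
        rw [Prod.dist_eq, dist_self]
        exact max_lt h1 hδ
      · rw [div_mul_eq_mul_div, div_lt_iff₀ (by positivity)]
        gcongr
    · intro v hv
      have h0 : ∀ r, g (r, v) = 0 := fun r => by
        by_contra h
        exact hv (hd _ h)
      rw [h0, h0, sub_zero]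
  simpa using herr.add hmain

end CellMeasures

/-! ### Convergence of the characteristic functionals -/

section RowLimit

/-- Cells are evaluated at their right endpoints, so t > T already puts the cell of t outside the
support; this permits the dominating function supported on [0, T]. -/
theorem le_gridTime_floor (n : ℕ+) (t : ℝ≥0) :
    t ≤ gridTime n ⌊((n : ℕ) : ℝ≥0) * t⌋₊.succPNat := by
  have hn : (0 : ℝ≥0) < ((n : ℕ) : ℝ≥0) := by exact_mod_cast n.pos
  rw [gridTime_succPNat, le_div_iff₀ hn, mul_comm]
  exact (Nat.lt_floor_add_one _).le

theorem tendsto_gridTime_floor (t : ℝ≥0) :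
    Tendsto (fun n : ℕ+ => gridTime n ⌊((n : ℕ) : ℝ≥0) * t⌋₊.succPNat) atTop (𝓝 t) := by
  have h1 : Tendsto (fun n : ℕ+ => t + (((n : ℕ) : ℝ≥0))⁻¹) atTop (𝓝 t) := by
    simpa using ((tendsto_inv_atTop_nhds_zero_nat (𝕜 := ℝ≥0)).comp
      tendsto_PNat_val_atTop_atTop).const_add t
  refine tendsto_of_tendsto_of_tendsto_of_le_of_le tendsto_const_nhds h1
    (fun n => le_gridTime_floor n t) fun n => ?_
  have hn : (0 : ℝ≥0) < ((n : ℕ) : ℝ≥0) := by exact_mod_cast n.pos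
  change gridTime n _ ≤ t + _
  rw [gridTime_succPNat, div_le_iff₀ hn, add_mul, inv_mul_cancel₀ hn.ne', mul_comm t]
  gcongr
  exact Nat.floor_le zero_le

theorem evalPos_exp_sub_one (f : StateSpace → ℝ) (t : ℝ≥0) (y : ℝ) :
    Complex.exp (evalPos f t y * Complex.I) =
      1 + evalPos (fun p => Complex.exp (f p * Complex.I) - 1) t y := by
  by_cases h : 0 < y
  · rw [evalPos_of_pos _ _ h, evalPos_of_pos _ _ h, add_sub_cancel]
  · rw [evalPos_of_not_pos _ _ h, evalPos_of_not_pos _ _ h]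
    simp

theorem norm_evalPos_le {g : StateSpace → ℂ} {C : ℝ} (hC : 0 ≤ C) (hg : ∀ p, ‖g p‖ ≤ C) (t : ℝ≥0)
    (y : ℝ) : ‖evalPos g t y‖ ≤ C := by
  by_cases h : 0 < y
  · rw [evalPos_of_pos _ _ h]
    exact hg _
  · rw [evalPos_of_not_pos _ _ h, norm_zero]
    exact hC

theorem norm_exp_mul_I_sub_one_le_two (x : ℝ) : ‖Complex.exp (x * Complex.I) - 1‖ ≤ 2 := by
  refine (norm_sub_le _ _).trans ?_
  rw [Complex.norm_exp_ofReal_mul_I, norm_one]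
  norm_num

variable {Ω : Type*} [MeasurableSpace Ω] {P : Measure Ω} [IsProbabilityMeasure P]

theorem integral_exp_evalPos {f : StateSpace → ℝ} (hf : Continuous f) {Y : Ω → ℝ}
    (hY : Measurable Y) (t : ℝ≥0) :
    ∫ ω, Complex.exp (evalPos f t (Y ω) * Complex.I) ∂P =
      1 + ∫ ω, evalPos (fun p => Complex.exp (f p * Complex.I) - 1) t (Y ω) ∂P := by
  have hg : Measurable fun p => Complex.exp (f p * Complex.I) - 1 := by
    have := hf.measurable
    fun_prop
  simp_rw [evalPos_exp_sub_one]
  rw [integral_add (integrable_const _)]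
  · simp
  · exact Integrable.of_bound ((measurable_evalPos hg t).comp hY).aestronglyMeasurable 2
      (.of_forall fun ω => norm_evalPos_le zero_le_two (fun p => norm_exp_mul_I_sub_one_le_two _) _ _)

/-- The characteristic functional of a row of independent points. -/
theorem integral_exp_rowPointMeasure {Y : ℕ+ → Ω → ℝ} (hY : ∀ k, Measurable (Y k))
    (hind : iIndepFun Y P) (f : C_c(StateSpace, ℝ)) {n : ℕ+} {N : ℕ}
    (hN : ∀ j : ℕ, N ≤ j → ∀ x, f (gridTime n j.succPNat, x) = 0) :
    ∫ ω, Complex.exp ((∫ p, f p ∂(rowPointMeasure n fun k => Y k ω).toMeasure : ℝ) *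
      Complex.I) ∂P = ∏ j ∈ Finset.range N, (1 + ∫ ω, evalPos
        (fun p => Complex.exp (f p * Complex.I) - 1) (gridTime n j.succPNat)
        (Y j.succPNat ω) ∂P) := by
  have hind' : iIndepFun (fun (i : Fin N) => Y (i : ℕ).succPNat) P :=
    hind.precomp (g := fun i : Fin N => (i : ℕ).succPNat)
      (Nat.succPNat_injective.comp Fin.val_injective)
  have hF : ∀ i : Fin N, Measurable fun y : ℝ =>
      Complex.exp (evalPos f (gridTime n (i : ℕ).succPNat) y * Complex.I) := by
    intro i
    have := measurable_evalPos f.continuous.measurable (gridTime n (i : ℕ).succPNat)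
    fun_prop
  have h := hind'.integral_fun_prod_comp (f := fun (i : Fin N) y =>
    Complex.exp (evalPos f (gridTime n (i : ℕ).succPNat) y * Complex.I))
    (fun i => (hY _).aemeasurable) fun i => (hF i).aestronglyMeasurable
  rw [Finset.prod_range]
  refine Eq.trans (integral_congr_ae (.of_forall fun ω => ?_)) (h.trans
    (Finset.prod_congr rfl fun i _ => integral_exp_evalPos f.continuous (hY _) _))
  change Complex.exp ((∫ p, f p ∂(rowPointMeasure n fun k => Y k ω).toMeasure : ℝ) *
      Complex.I) = _
  have hrow : ∫ p, f p ∂(rowPointMeasure n fun k => Y k ω).toMeasure =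
      ∑ j ∈ Finset.range N, evalPos f (gridTime n j.succPNat) (Y j.succPNat ω) :=
    integral_rowPointMeasure f.continuous f.hasCompactSupport hN fun k => Y k ω
  rw [hrow, ← Complex.exp_sum,
    Finset.sum_range, Complex.ofReal_sum, Finset.sum_mul]

/-- Convergence of the characteristic functionals of rows of independent points whose rescaled
tails converge. -/
theorem tendsto_integral_exp_rowPointMeasure {β : ℝ≥0 → ℝ} (hβ : Continuous β)
    (hpos : ∀ t, 0 < β t) {Y : ℕ+ → ℕ+ → Ω → ℝ} (hY : ∀ n k, Measurable (Y n k))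
    (hind : ∀ n, iIndepFun (Y n) P) {F : ℕ+ → ℝ → ℝ}
    (hF : ∀ n k v, 0 < v → P.real {ω | v ^ (-(β (gridTime n k))⁻¹) < Y n k ω} = F n v)
    (hFlim : ∀ v, 0 < v → Tendsto (fun n : ℕ+ => ((n : ℕ) : ℝ) * F n v) atTop (𝓝 v))
    (f : C_c(StateSpace, ℝ)) :
    Tendsto (fun n : ℕ+ => ∫ ω, Complex.exp
        ((∫ p, f p ∂(rowPointMeasure n fun k => Y n k ω).toMeasure : ℝ) * Complex.I) ∂P)
      atTop (𝓝 (Complex.exp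
        (∫ p, (Complex.exp (f p * Complex.I) - 1) ∂multistableIntensity β))) := by
  let g : StateSpace → ℂ := fun p => Complex.exp (f p * Complex.I) - 1
  have hg : Continuous g := by
    have := f.continuous
    fun_prop
  have hgc : HasCompactSupport g :=
    f.hasCompactSupport.comp_left (g := fun x : ℝ => Complex.exp (x * Complex.I) - 1) (by simp)
  have hg2 : ∀ p, ‖g p‖ ≤ 2 := fun p => norm_exp_mul_I_sub_one_le_two _
  let k : StateSpace → ℂ := fun p => g (tailHomeomorph hβ hpos p)
  have hk : Continuous k := hg.comp (tailHomeomorph hβ hpos).continuous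
  have hkc : HasCompactSupport k := hgc.comp_homeomorph _
  obtain ⟨T, hT⟩ := exists_bound_fst hgc
  obtain ⟨Tf, hTf⟩ := exists_bound_fst f.hasCompactSupport
  obtain ⟨d, hd0, hd⟩ := exists_bound_snd hkc
  let s : ℕ+ → ℕ → ℝ≥0 := fun n j => gridTime n j.succPNat
  let z : ℕ+ → ℕ → ℂ := fun n j => ∫ ω, evalPos g (s n j) (Y n j.succPNat ω) ∂P
  let ρ : ℕ+ → ℕ → Measure (Set.Ioi (0 : ℝ)) := fun n j =>
    cellMeasure (β (s n j)) (Y n j.succPNat) P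
  have hρfin : ∀ n j, IsFiniteMeasure (ρ n j) := fun n j => isFiniteMeasure_cellMeasure
  have hz : ∀ n j, z n j = ∫ v, k (s n j, v) ∂ρ n j := fun n j =>
    integral_evalPos_eq_integral_cellMeasure (hY _ _) (hpos _) hg.measurable _
  have hρ : ∀ n j v, 0 < v → (ρ n j).real {x | (x : ℝ) < v} = F n v := fun n j v hv =>
    (cellMeasure_real_setOf_lt (hY _ _) (hpos _) hv).trans (hF _ _ _ hv)
  -- A point matters only if its coordinate v is below `d`, an event of probability `F n d` in every
  -- cell.
  have hzbound : ∀ n j, ‖z n j‖ ≤ 2 * F n d := by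
    intro n j
    rw [hz, ← setIntegral_eq_integral_of_forall_compl_eq_zero
      (s := {x : Set.Ioi (0 : ℝ) | (x : ℝ) < d}), ← hρ n j d hd0]
    · exact norm_setIntegral_le_of_norm_le_const (measure_lt_top _ _) fun v _ => hg2 _
    · intro v hv
      by_contra h
      exact hv (hd _ h)
  have hzero : ∀ n j, (∀ x, g (s n j, x) = 0) → z n j = 0 := by
    intro n j h
    rw [hz]
    refine integral_eq_zero_of_ae (.of_forall fun v => h _)
  have hone : ∀ n j, ‖1 + z n j‖ ≤ 1 := by
    intro n j
    refine (congrArg norm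
      (integral_exp_evalPos f.continuous (hY n j.succPNat) (s n j)).symm).trans_le ?_
    refine (norm_integral_le_of_norm_le_const (C := 1) (.of_forall fun ω => ?_)).trans (by simp)
    exact (Complex.norm_exp_ofReal_mul_I _).le
  -- Beyond `N n` both `f` (for the product formula) and `g` (for the sum) must vanish.
  let N : ℕ+ → ℕ := fun n => ⌈max T Tf * ((n : ℕ) : ℝ≥0)⌉₊
  have hNf : ∀ n j, N n ≤ j → ∀ x, f (s n j, x) = 0 := fun n j hj x =>
    eq_zero_of_ceil_le (fun p hp => (hTf p hp).trans (le_max_right _ _)) hj x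
  have hNg : ∀ n j, N n ≤ j → z n j = 0 := fun n j hj =>
    hzero n j fun x => eq_zero_of_ceil_le (fun p hp => (hT p hp).trans (le_max_left _ _)) hj x
  simp_rw [fun n => integral_exp_rowPointMeasure (hY n) (hind n) f (hNf n)]
  have hFd := hFlim d hd0
  have hinv : Tendsto (fun n : ℕ+ => (((n : ℕ) : ℝ))⁻¹) atTop (𝓝 0) :=
    tendsto_inv_atTop_nhds_zero_nat.comp tendsto_PNat_val_atTop_atTop
  have hn0 : ∀ n : ℕ+, (0 : ℝ) < ((n : ℕ) : ℝ) := fun n => by exact_mod_cast n.pos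
  have hc : Tendsto (fun n => 2 * F n d) atTop (𝓝 0) := by
    have := (hinv.mul hFd).const_mul 2
    rw [zero_mul, mul_zero] at this
    refine this.congr fun n => ?_
    have := (hn0 n).ne'
    field_simp
  refine tendsto_prod_one_add_of_tendsto_sum (c := fun n => 2 * F n d) ?_ hone
    (.of_forall hzbound) hc ?_
  · have hsum : ∀ n, ∑ j ∈ Finset.range (N n), z n j =
        ∫ t, ((n : ℕ) : ℂ) * z n ⌊((n : ℕ) : ℝ≥0) * t⌋₊
          ∂((volume : Measure ℝ).comap ((↑) : ℝ≥0 → ℝ)) := by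
      intro n
      rw [integral_comp_floor_mul n.pos (φ := fun j => ((n : ℕ) : ℂ) * z n j)
        fun j hj => by rw [hNg n j hj, mul_zero], ← Finset.mul_sum, inv_mul_cancel_left₀]
      exact_mod_cast n.ne_zero
    change Tendsto (fun n => ∑ j ∈ Finset.range (N n), z n j) _ _
    simp_rw [hsum]
    rw [integral_multistableIntensity hβ hpos hg hgc]
    refine tendsto_integral_filter_of_dominated_convergence
      ((Set.Iic T).indicator fun _ => 2 * (d + 1)) (.of_forall fun n => ?_) ?_ ?_
      (.of_forall fun t => ?_)
    · refine Measurable.aestronglyMeasurable ?_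
      exact (measurable_from_nat (f := fun j => ((n : ℕ) : ℂ) * z n j)).comp
        (Nat.measurable_floor.comp (measurable_const_mul _))
    · filter_upwards [hFd.eventually_le_const (lt_add_one d)] with n hn
      refine .of_forall fun t => ?_
      by_cases ht : t ≤ T
      · rw [Set.indicator_of_mem (Set.mem_Iic.2 ht), norm_mul, Complex.norm_natCast]
        calc ((n : ℕ) : ℝ) * ‖z n ⌊((n : ℕ) : ℝ≥0) * t⌋₊‖ ≤ ((n : ℕ) : ℝ) * (2 * F n d) := by
              gcongr
              exact hzbound _ _
          _ = 2 * (((n : ℕ) : ℝ) * F n d) := by ring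
          _ ≤ 2 * (d + 1) := by gcongr
      · rw [hzero, mul_zero, norm_zero]
        · exact Set.indicator_nonneg (fun _ _ => by positivity) _
        · intro x
          by_contra h
          exact ht ((le_gridTime_floor n t).trans (hT _ h))
    · rw [integrable_indicator_iff measurableSet_Iic]
      refine integrableOn_const ?_
      have : Set.Iic T = Set.Icc 0 T := by
        ext x
        simp
      rw [this]
      exact isCompact_Icc.measure_lt_top.ne
    -- At fixed t, n times the law in the cell of t has distribution function n · `F n v` → v, while
    -- the section time tends to t.
    · let μ : ℕ+ → Measure (Set.Ioi (0 : ℝ)) := fun n =>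
        ((n : ℕ) : ℝ≥0) • ρ n ⌊((n : ℕ) : ℝ≥0) * t⌋₊
      have hμ : ∀ v : ℝ, 0 < v →
          Tendsto (fun n => (μ n).real {x | (x : ℝ) < v}) atTop (𝓝 v) := by
        intro v hv
        refine (hFlim v hv).congr fun n => ?_
        simp only [μ, measureReal_nnreal_smul_apply, hρ _ _ v hv]
        rfl
      refine (tendsto_integral_section hμ hk hkc (tendsto_gridTime_floor t)).congr fun n => ?_
      rw [hz, integral_smul_nnreal_measure]
      simp [s, NNReal.smul_def]
  -- With `N n` ≤ (max T Tf + 1) n, the quantity is at most 4 (max T Tf + 1) (n · `F n d`)² / n.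
  · have hlim := ((hinv.mul (hFd.pow 2)).const_mul (4 * ((max T Tf : ℝ≥0) + 1 : ℝ)))
    rw [zero_mul, mul_zero] at hlim
    refine squeeze_zero (fun n => by positivity) (fun n => ?_) hlim
    have hNn : (N n : ℝ) ≤ ((max T Tf : ℝ≥0) + 1 : ℝ) * ((n : ℕ) : ℝ) := by
      have h1 : (N n : ℝ≥0) < max T Tf * ((n : ℕ) : ℝ≥0) + 1 := Nat.ceil_lt_add_one zero_le
      have h2 : (N n : ℝ) < (max T Tf : ℝ≥0) * ((n : ℕ) : ℝ) + 1 := by exact_mod_cast h1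
      have h3 : (1 : ℝ) ≤ ((n : ℕ) : ℝ) := by exact_mod_cast n.pos
      linarith
    calc (N n : ℝ) * (2 * F n d) ^ 2
        ≤ (((max T Tf : ℝ≥0) + 1 : ℝ) * ((n : ℕ) : ℝ)) * (2 * F n d) ^ 2 := by gcongr
      _ = _ := by
        have := (hn0 n).ne'
        field_simp
        ring

end RowLimit

/-! ### Exponent bookkeeping for the norming -/

section TailFunction

variable {β : ℝ≥0 → ℝ}

theorem indexSup_pos (hβ_mem : ∀ t, β t ∈ Set.Ioo (0 : ℝ) 1) : 0 < indexSup β :=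
  (hβ_mem 0).1.trans_le (le_ciSup (f := β) ⟨1, by rintro _ ⟨t, rfl⟩; exact (hβ_mem t).2.le⟩ 0)

/-- A tail with index `b`, as a tail with index `α` at the power `b / α`. -/
theorem rpow_neg_mul_comp_rpow_div {L : ℝ → ℝ} {b α t : ℝ} (hα : α ≠ 0) (ht : 0 < t) :
    t ^ (-b) * L (t ^ (b / α)) = (t ^ (b / α)) ^ (-α) * L (t ^ (b / α)) := by
  rw [← Real.rpow_mul ht.le, mul_neg, div_mul_cancel₀ _ hα]

/-- This cancellation of `b` makes the rescaled tails the same in all cells of a row. -/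
theorem rpow_normConst_mul {a b α v : ℝ} (ha : 0 < a) (hb : 0 < b) (hα : 0 < α) (hv : 0 < v) :
    (a ^ (α / b) * v ^ (-b⁻¹)) ^ (b / α) = v ^ (-α⁻¹) * a := by
  rw [Real.mul_rpow (Real.rpow_pos_of_pos ha _).le (Real.rpow_pos_of_pos hv _).le,
    ← Real.rpow_mul ha.le, ← Real.rpow_mul hv.le, mul_comm]
  congr 1
  · congr 1
    field_simp
  · rw [div_mul_div_cancel₀ hb.ne', div_self hα.ne', Real.rpow_one]

end TailFunction

theorem mainTheorem3
    (β : ℝ≥0 → ℝ) (hβ_cont : Continuous β) (hβ_mem : ∀ t, β t ∈ Set.Ioo (0 : ℝ) 1)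
    {Ω : Type*} [MeasurableSpace Ω] (P : Measure Ω) [IsProbabilityMeasure P]
    (J : ℕ+ → ℕ+ → Ω → ℝ) (hJ_meas : ∀ n k, Measurable (J n k))
    (hJ_nonneg : ∀ n k, ∀ᵐ ω ∂P, 0 ≤ J n k ω)
    (hJ_indep : iIndepFun (fun p : ℕ+ × ℕ+ => J p.1 p.2) P)
    (L : ℝ → ℝ) (hL : IsSlowlyVarying L)
    (hJ_tail : ∀ n k, ∀ t : ℝ, 0 < t →
      P.real {ω | t < J n k ω} =
        t ^ (-β (gridTime n k)) * L (t ^ (β (gridTime n k) / indexSup β)))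
    (a : ℕ+ → ℝ) (ha_pos : ∀ n, 0 < a n)
    (ha : ∀ᶠ n : ℕ+ in atTop, a n ^ (-indexSup β) * L (a n) = 1 / ((n : ℕ) : ℝ))
    {Ω' : Type*} [MeasurableSpace Ω'] (P' : Measure Ω') [IsProbabilityMeasure P']
    (Pi : Ω' → PointMeasure StateSpace)
    (hPi : IsPoissonPointProcess Pi (multistableIntensity β) P') :
    TendstoInDistribution
      (fun (n : ℕ+) (ω : Ω) =>
        rowPointMeasure n (fun k => (normConst β a n k)⁻¹ * J n k ω))
      atTop Pi (fun _ => P) P' := by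
  have hpos : ∀ t, 0 < β t := fun t => (hβ_mem t).1
  have hα := indexSup_pos hβ_mem
  set α := indexSup β with hαdef
  have htail : ∀ n k, ∀ t : ℝ, 0 < t → P.real {ω | t < J n k ω} =
      (t ^ (β (gridTime n k) / α)) ^ (-α) * L (t ^ (β (gridTime n k) / α)) := fun n k t ht =>
    (hJ_tail n k t ht).trans (rpow_neg_mul_comp_rpow_div hα.ne' ht)
  -- The tail function is itself a tail of `J 1 1` after a change of power; any cell would do.
  -- Nonnegativity and monotonicity then come for free.
  have hG : ∀ u : ℝ, 0 < u →
      u ^ (-α) * L u = P.real {ω | u ^ (α / β (gridTime 1 1)) < J 1 1 ω} := by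
    intro u hu
    rw [htail 1 1 _ (Real.rpow_pos_of_pos hu _), ← Real.rpow_mul hu.le,
      div_mul_div_cancel₀ (hpos _).ne', div_self hα.ne', Real.rpow_one]
  have hnonneg : ∀ u : ℝ, 0 < u → 0 ≤ u ^ (-α) * L u := fun u hu => by
    rw [hG u hu]
    exact measureReal_nonneg
  have hanti : AntitoneOn (fun u => u ^ (-α) * L u) (Set.Ioi 0) := by
    intro u hu w hw huw
    simp only
    rw [hG u hu, hG w hw]
    refine measureReal_mono fun ω (hω : w ^ (α / β (gridTime 1 1)) < J 1 1 ω) => ?_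
    exact (Real.rpow_le_rpow (le_of_lt hu) huw (div_pos hα (hpos _)).le).trans_lt hω
  have hb : ∀ n k, 0 < normConst β a n k := fun n k => Real.rpow_pos_of_pos (ha_pos n) _
  let Y : ℕ+ → ℕ+ → Ω → ℝ := fun n k ω => (normConst β a n k)⁻¹ * J n k ω
  have hY : ∀ n k, Measurable (Y n k) := fun n k => (hJ_meas n k).const_mul _
  have hind : ∀ n, iIndepFun (Y n) P := fun n =>
    (hJ_indep.precomp (g := fun k : ℕ+ => (n, k)) fun k k' h => (Prod.ext_iff.1 h).2).comp
      (fun k x => (normConst β a n k)⁻¹ * x) fun k => measurable_const_mul _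
  let F : ℕ+ → ℝ → ℝ := fun n v =>
    (v ^ (-α⁻¹) * a n) ^ (-α) * L (v ^ (-α⁻¹) * a n)
  have hF : ∀ n k v, 0 < v →
      P.real {ω | v ^ (-(β (gridTime n k))⁻¹) < Y n k ω} = F n v := by
    intro n k v hv
    have hset : {ω | v ^ (-(β (gridTime n k))⁻¹) < Y n k ω} =
        {ω | normConst β a n k * v ^ (-(β (gridTime n k))⁻¹) < J n k ω} := by
      ext ω
      exact lt_inv_mul_iff₀ (hb n k)
    rw [hset, htail n k _ (mul_pos (hb n k) (Real.rpow_pos_of_pos hv _)), normConst,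
      rpow_normConst_mul (ha_pos n) (hpos _) hα hv]
  have hFlim : ∀ v, 0 < v → Tendsto (fun n : ℕ+ => ((n : ℕ) : ℝ) * F n v) atTop (𝓝 v) := by
    intro v hv
    have h := hL.tendsto_mul_tail hanti hnonneg ha_pos ha (Real.rpow_pos_of_pos hv (-α⁻¹))
    rwa [← Real.rpow_mul hv.le, neg_mul_neg, inv_mul_cancel₀ hα.ne', Real.rpow_one] at h
  have hN : ∀ n, Measurable fun ω => rowPointMeasure n fun k => Y n k ω := fun n =>
    measurable_rowPointMeasure (hY n)
  have := isFiniteMeasureOnCompacts_multistableIntensity hβ_cont hpos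
  refine ⟨fun n => (hN n).aemeasurable, hPi.measurable.aemeasurable, ?_⟩
  refine tendsto_probabilityMeasure_of_tendsto_integral_exp (φ := fun (μ : PointMeasure StateSpace)
    (f : C_c(StateSpace, ℝ)) => ∫ x, f x ∂μ.toMeasure) ⟨rfl⟩ fun s c => ?_
  -- A linear combination of test functions is a test function, so a single functional suffices.
  let f : C_c(StateSpace, ℝ) := ∑ i : s, c i • (i : C_c(StateSpace, ℝ))
  have hf : ∀ μ : PointMeasure StateSpace,
      ∑ i : s, c i * ∫ x, (i : C_c(StateSpace, ℝ)) x ∂μ.toMeasure = ∫ x, f x ∂μ.toMeasure := by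
    intro μ
    have hfx : ∀ x, f x = ∑ i : s, c i * (i : C_c(StateSpace, ℝ)) x := by
      intro x
      simp [f, CompactlySupportedContinuousMap.sum_apply]
    simp_rw [hfx]
    rw [integral_finsetSum]
    · simp_rw [integral_const_mul]
    · exact fun i _ => (μ.integrable_of_hasCompactSupport i.1.continuous
        i.1.hasCompactSupport).const_mul _
  have hexp : Measurable fun μ : PointMeasure StateSpace =>
      Complex.exp ((∫ x, f x ∂μ.toMeasure : ℝ) * Complex.I) := by
    have := (PointMeasure.continuous_integral f).measurable
    fun_prop
  simp only [ProbabilityMeasure.coe_mk, hf]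
  rw [integral_map hPi.measurable.aemeasurable hexp.aestronglyMeasurable, hPi.integral_exp f]
  refine (tendsto_integral_exp_rowPointMeasure hβ_cont hpos hY hind hF hFlim f).congr fun n => ?_
  exact (integral_map (hN n).aemeasurable hexp.aestronglyMeasurable).symm
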